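/- Let $0<q<1$. **Symmetry algebra.** $U_q\mathfrak{su}(1,1)$ is generated by $H$, $X^\pm$ and $K^{\pm1}$, $K=q^{-H/2}$, with comultiplication $\Delta H=H\otimes 1+1\otimes H$, $\Delta K=K\otimes K$, $\Delta X^\pm=X^\pm\otimes K+K^{-1}\otimes X^\pm$; it acts on the algebras below so that products are acted on through $\Delta$. A morphism of $U_q\mathfrak{su}(1,1)$-modules is a linear map commuting with the generators, and a morphism of covariant $*$-algebras is a linear, multiplicative, $*$-preserving morphism of $U_q\mathfrak{su}(1,1)$-modules. **Quantum disc.** $\mathrm{Pol}(\mathbb C)_q$ is the $*$-algebra generated by $z$ with $z^*z=q^2zz^*+1-q^2$, and $Hz=2z$, $X^+z=-q^{-1/2}z^2$, $X^-z=q^{1/2}$, $Hz^*=-2z^*$, $X^+z^*=q^{-1/2}$, $X^-z^*=-q^{1/2}z^{*2}$. With $y=1-zz^*$, each element is uniquely $\sum_{j>0}z^j\psi_j(y)+\psi_0(y)+\sum_{j>0}\psi_{-j}(y)z^{*j}$ with polynomials $\psi_j$. The weakest topology making all functionals $f\mapsto\psi_j(q^{2m})$ ($j\in\mathbb Z$,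 $m\in\mathbb Z_+$) continuous has as completion the space $D(U)_q'$ of such formal series whose coefficients are functions on $q^{2\mathbb Z_+}$, with pointwise convergence. $D(U)_q\subset D(U)'_q$ is the subspace of finite functions, those with finitely many non-zero values $\psi_j(q^{2m})$. The element $f_0=\psi_0(y)\in D(U)_q$ has $\psi_0(1)=1$ and $\psi_0=0$ on $\{q^2,q^4,\dots\}$. **Quantum principal homogeneous space.** $\mathrm{Pol}(\widetilde X)_q$ is the algebra with generators $t_{ij}$ ($i,j=1,2$) and relations $t_{11}t_{12}=qt_{12}t_{11}$, $t_{21}t_{22}=qt_{22}t_{21}$, $t_{11}t_{21}=qt_{21}t_{11}$, $t_{12}t_{22}=qt_{22}t_{12}$, $t_{12}t_{21}=t_{21}t_{12}$, $t_{11}t_{22}-t_{22}t_{11}=(q-q^{-1})t_{12}t_{21}$, $t_{11}t_{22}-qt_{12}t_{21}=1$, with involution $t_{11}^*=-t_{22}$, $t_{12}^*=-qt_{21}$ and action $Ht_{i1}=t_{i1}$, $Ht_{i2}=-t_{i2}$, $X^+t_{i1}=0$, $X^+t_{i2}=t_{i1}$, $X^-t_{i1}=t_{i2}$, $X^-t_{i2}=0$.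 With $x=t_{12}t_{12}^*$, each element is uniquely $\sum t_{11}^{i_1}t_{12}^{i_2}\psi_{i_1i_2j_1j_2}(x)t_{12}^{*j_2}t_{11}^{*j_1}$ with polynomials $\psi_{i_1i_2j_1j_2}$, the sum being over $(i_1,i_2,j_1,j_2)\in\mathbb Z_+^4$ with $i_1j_1=i_2j_2=0$. As before, the functionals $f\mapsto\psi_{i_1i_2j_1j_2}(q^{-2m})$ ($m\in\mathbb Z_+$) define a topology whose completion $D(\widetilde X)_q'$ consists of such formal series with coefficients functions on $q^{-2\mathbb Z_+}$; $D(\widetilde X)_q$ is the subspace of finite functions. The element $e_0=\psi_{0000}(x)$ has $\psi_{0000}(1)=1$ and $\psi_{0000}=0$ on $\{q^{-2},q^{-4},\dots\}$. In both cases the action and the involution extend by continuity to distributions. So do the products of polynomials with distributions, and then the products of finite functions with distributions; finite functions thus form a covariant $*$-algebra, and distributions a covariant bimodule over it. The automorphisms $i_\varphi$ of $\mathrm{Pol}(\widetilde X)_q$, $i_\varphi(t_{1j})=e^{i\varphi}t_{1j}$, $i_\varphi(t_{2j})=e^{-i\varphi}t_{2j}$ ($\varphi\in\mathbb R/2\pi\mathbb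 Z$), also extend by continuity to $D(\widetilde X)_q'$. Let $D(X)_q\subset D(\widetilde X)_q$ and $D(X)'_q\subset D(\widetilde X)_q'$ be the subspaces of elements fixed by all $i_\varphi$. **Proposition 3.1.** There exists a unique isomorphism $i:D(U)_q\to D(X)_q$ of covariant $*$-algebras such that $i(f_0)=e_0$. It has a unique continuous extension $\overline i:D(U)'_q\to D(X)'_q$. This extension is an isomorphism of $U_q\mathfrak{su}(1,1)$-modules and a homeomorphism, and it agrees with the bimodule structures: $\overline i(gF)=i(g)\,\overline i(F)$ and $\overline i(Fg)=\overline i(F)\,i(g)$ for $g\in D(U)_q$, $F\in D(U)'_q$. Moreover $\overline i(z)=q\,t_{11}t_{12}^{-1}$ and $\overline i(z^*)=t_{21}^{-1}t_{22}$, where $t_{12}^{-1},t_{21}^{-1}\in D(\widetilde X)'_q$ are the two-sided inverses of $t_{12}$ and $t_{21}$. -/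

import Mathlib

open Filter Topology Polynomial

noncomputable section

namespace QDisc

/-! ### The deformation parameter -/

/-- The deformation parameter `q` ranges over `(0, 1)`; `q = e^{-h/2}`. -/
abbrev Param : Type := Set.Ioo (0 : ℝ) 1

/-- `q` as a complex number. -/
def qc (q : Param) : ℂ := ((q : ℝ) : ℂ)

/-- `q^{1/2}` as a complex number. -/
def sq (q : Param) : ℂ := ((Real.sqrt (q : ℝ) : ℝ) : ℂ)

theorem sq_ne_zero (q : Param) : sq q ≠ 0 := by
  have h : Real.sqrt (q : ℝ) ≠ 0 := (Real.sqrt_pos.2 q.2.1).ne'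
  simpa [sq] using h

theorem qc_eq (q : Param) : qc q = sq q ^ 2 := by
  have h : (Real.sqrt (q : ℝ)) ^ 2 = (q : ℝ) := Real.sq_sqrt q.2.1.le
  rw [qc, sq, ← Complex.ofReal_pow, h]

theorem conj_qc (q : Param) : (starRingEnd ℂ) (qc q) = qc q := Complex.conj_ofReal _

/-- The generators of the Hopf algebra `U_q su(1,1)`: `H`, `X⁺`, `X⁻` and
`K = e^{hH/4} = q^{-H/2}`, `Kinv = e^{-hH/4} = q^{H/2}`. The comultiplication is
`Δ H = H ⊗ 1 + 1 ⊗ H`, `Δ K = K ⊗ K`, `Δ X^± = X^± ⊗ K + K⁻¹ ⊗ X^±`. A linear map between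
modules is a morphism of `U_q su(1,1)`-modules iff it commutes with these generators. -/
inductive UqGen
  | H | K | Kinv | Xp | Xm

/-! ### Antilinear maps as algebra homomorphisms

`ConjOp A` is the opposite algebra of `A` with scalars acting through complex conjugation. An
algebra homomorphism `A → ConjOp A` is the same thing as an antilinear antimultiplicative map
`A → A`, that is, an additive map with `(ab)* = b* a*` and `(c a)* = conj(c) a*`. -/

/-- The opposite algebra with conjugated scalars. -/
def ConjOp (A : Type) : Type := Aᵐᵒᵖ

instance (A : Type) [Ring A] : Ring (ConjOp A) := inferInstanceAs (Ring Aᵐᵒᵖ)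

instance (A : Type) [Ring A] [Algebra ℂ A] : Algebra ℂ (ConjOp A) :=
  RingHom.toAlgebra' ((algebraMap ℂ Aᵐᵒᵖ).comp (starRingEnd ℂ))
    (fun c x => Algebra.commutes (A := Aᵐᵒᵖ) ((starRingEnd ℂ) c) x)

/-- The element of `ConjOp A` given by an element of `A`. -/
def toConj {A : Type} (a : A) : ConjOp A := MulOpposite.op a

/-- The element of `A` underlying an element of `ConjOp A`. -/
def ofConj {A : Type} (a : ConjOp A) : A := MulOpposite.unop a

theorem toConj_mul {A : Type} [Ring A] (a b : A) : toConj a * toConj b = toConj (b * a) := rfl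

theorem toConj_add {A : Type} [Ring A] (a b : A) : toConj a + toConj b = toConj (a + b) := rfl

theorem toConj_sub {A : Type} [Ring A] (a b : A) : toConj a - toConj b = toConj (a - b) := rfl

theorem toConj_one {A : Type} [Ring A] : (1 : ConjOp A) = toConj (1 : A) := rfl

theorem smul_toConj {A : Type} [Ring A] [Algebra ℂ A] (c : ℂ) (a : A) :
    c • toConj a = toConj ((starRingEnd ℂ) c • a) := by
  rw [Algebra.smul_def, Algebra.smul_def]
  exact Algebra.commutes (A := Aᵐᵒᵖ) ((starRingEnd ℂ) c) (MulOpposite.op a)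

/-! ### The algebra of polynomials on the quantum principal homogeneous space -/

/-- The generators `t_{ij}` of `ℂ[SL₂]_q`. -/
inductive GenX
  | t11 | t12 | t21 | t22

open FreeAlgebra in
/-- The defining relations of `ℂ[SL₂]_q`. -/
inductive RelX (q : Param) : FreeAlgebra ℂ GenX → FreeAlgebra ℂ GenX → Prop
  | r1 : RelX q (ι ℂ .t11 * ι ℂ .t12) (qc q • (ι ℂ .t12 * ι ℂ .t11))
  | r2 : RelX q (ι ℂ .t21 * ι ℂ .t22) (qc q • (ι ℂ .t22 * ι ℂ .t21))
  | r3 : RelX q (ι ℂ .t11 * ι ℂ .t21) (qc q • (ι ℂ .t21 * ι ℂ .t11))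
  | r4 : RelX q (ι ℂ .t12 * ι ℂ .t22) (qc q • (ι ℂ .t22 * ι ℂ .t12))
  | r5 : RelX q (ι ℂ .t12 * ι ℂ .t21) (ι ℂ .t21 * ι ℂ .t12)
  | r6 : RelX q (ι ℂ .t11 * ι ℂ .t22 - ι ℂ .t22 * ι ℂ .t11)
      ((qc q - (qc q)⁻¹) • (ι ℂ .t12 * ι ℂ .t21))
  | r7 : RelX q (ι ℂ .t11 * ι ℂ .t22 - qc q • (ι ℂ .t12 * ι ℂ .t21)) 1

/-- The algebra `ℂ[SL₂]_q`, which underlies the `*`-algebra `Pol(X̃)_q`. -/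
def PolX (q : Param) : Type := RingQuot (RelX q)

instance (q : Param) : Ring (PolX q) := inferInstanceAs (Ring (RingQuot (RelX q)))

instance (q : Param) : Algebra ℂ (PolX q) := inferInstanceAs (Algebra ℂ (RingQuot (RelX q)))

/-- The quotient map onto `ℂ[SL₂]_q`. -/
def mkX (q : Param) : FreeAlgebra ℂ GenX →ₐ[ℂ] PolX q := RingQuot.mkAlgHom ℂ (RelX q)

theorem mkX_rel (q : Param) {a b : FreeAlgebra ℂ GenX} (h : RelX q a b) : mkX q a = mkX q b :=
  RingQuot.mkAlgHom_rel ℂ h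

/-- The image of a generator in `Pol(X̃)_q`. -/
def tX (q : Param) (g : GenX) : PolX q := mkX q (FreeAlgebra.ι ℂ g)

section RelationsX
variable (q : Param)

theorem tX_r1 : tX q .t11 * tX q .t12 = qc q • (tX q .t12 * tX q .t11) := by
  have h := mkX_rel q .r1
  simp only [map_mul, map_smul] at h
  exact h

theorem tX_r2 : tX q .t21 * tX q .t22 = qc q • (tX q .t22 * tX q .t21) := by
  have h := mkX_rel q .r2
  simp only [map_mul, map_smul] at h
  exact h

theorem tX_r3 : tX q .t11 * tX q .t21 = qc q • (tX q .t21 * tX q .t11) := by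
  have h := mkX_rel q .r3
  simp only [map_mul, map_smul] at h
  exact h

theorem tX_r4 : tX q .t12 * tX q .t22 = qc q • (tX q .t22 * tX q .t12) := by
  have h := mkX_rel q .r4
  simp only [map_mul, map_smul] at h
  exact h

theorem tX_r5 : tX q .t12 * tX q .t21 = tX q .t21 * tX q .t12 := by
  have h := mkX_rel q .r5
  simp only [map_mul] at h
  exact h

theorem tX_r7 : tX q .t11 * tX q .t22 = 1 + qc q • (tX q .t21 * tX q .t12) := by
  have h := mkX_rel q .r7
  simp only [map_sub, map_mul, map_smul, map_one] at h
  rw [← tX_r5, ← sub_eq_iff_eq_add]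
  exact h

theorem tX_r6 : tX q .t22 * tX q .t11 = 1 + (qc q)⁻¹ • (tX q .t21 * tX q .t12) := by
  have h := mkX_rel q .r6
  simp only [map_sub, map_mul, map_smul] at h
  have h' : tX q .t11 * tX q .t22 - tX q .t22 * tX q .t11
      = (qc q - (qc q)⁻¹) • (tX q .t12 * tX q .t21) := h
  rw [tX_r7, tX_r5, sub_smul, sub_eq_iff_eq_add] at h'
  rw [← sub_eq_zero] at h' ⊢
  rw [← neg_eq_zero, ← h']
  abel

end RelationsX

/-- The elements `g t_{ij}` of an algebra satisfy the defining relations of `ℂ[SL₂]_q`. -/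
structure RelsX (q : Param) {B : Type} [Ring B] [Algebra ℂ B] (g : GenX → B) : Prop where
  h1 : g .t11 * g .t12 = qc q • (g .t12 * g .t11)
  h2 : g .t21 * g .t22 = qc q • (g .t22 * g .t21)
  h3 : g .t11 * g .t21 = qc q • (g .t21 * g .t11)
  h4 : g .t12 * g .t22 = qc q • (g .t22 * g .t12)
  h5 : g .t12 * g .t21 = g .t21 * g .t12
  h6 : g .t11 * g .t22 - g .t22 * g .t11 = (qc q - (qc q)⁻¹) • (g .t12 * g .t21)
  h7 : g .t11 * g .t22 - qc q • (g .t12 * g .t21) = 1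

/-- Extension of an assignment on generators to an algebra homomorphism on `ℂ[SL₂]_q`. -/
def liftX (q : Param) {B : Type} [Ring B] [Algebra ℂ B] (g : GenX → B) (h : RelsX q g) :
    PolX q →ₐ[ℂ] B :=
  RingQuot.liftAlgHom ℂ ⟨FreeAlgebra.lift ℂ g, by
    intro a b hab
    cases hab
    · simpa using h.h1
    · simpa using h.h2
    · simpa using h.h3
    · simpa using h.h4
    · simpa using h.h5
    · simpa using h.h6
    · simpa using h.h7⟩

/-! ### Upper triangular matrices and twisted derivations

An algebra homomorphism of the form `a ↦ !![σ a, D a; 0, τ a]` encodes two homomorphisms `σ`, `τ`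
and a linear map `D` with `D (a b) = σ a * D b + D a * τ b`. -/

/-- The upper triangular matrix with diagonal `a`, `b` and upper right entry `d`. -/
def tri {A : Type} [Ring A] (a d b : A) : Matrix (Fin 2) (Fin 2) A := !![a, d; 0, b]

theorem tri_mul {A : Type} [Ring A] (a d b a' d' b' : A) :
    tri a d b * tri a' d' b' = tri (a * a') (a * d' + d * b') (b * b') := by
  simp [tri]

theorem tri_sub {A : Type} [Ring A] (a d b a' d' b' : A) :
    tri a d b - tri a' d' b' = tri (a - a') (d - d') (b - b') := by
  simp [tri]

theorem tri_smul {A : Type} [Ring A] [Algebra ℂ A] (c : ℂ) (a d b : A) :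
    c • tri a d b = tri (c • a) (c • d) (c • b) := by
  simp [tri]

theorem tri_one {A : Type} [Ring A] : (1 : Matrix (Fin 2) (Fin 2) A) = tri 1 0 1 := by
  simp [tri, Matrix.one_fin_two]

theorem tri_congr {A : Type} [Ring A] {a d b a' d' b' : A} (h1 : a = a') (h2 : d = d')
    (h3 : b = b') : tri a d b = tri a' d' b' := by
  rw [h1, h2, h3]

/-! ### Structure maps on `Pol(X̃)_q` -/

section StructX

set_option linter.unusedSimpArgs false

variable (q : Param)

/-- The values `t₁₁* = -t₂₂`, `t₁₂* = -q t₂₁`, `t₂₁* = -q⁻¹ t₁₂`, `t₂₂* = -t₁₁`. -/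
def starGenX : GenX → PolX q
  | .t11 => -tX q .t22
  | .t12 => -(qc q • tX q .t21)
  | .t21 => -((qc q)⁻¹ • tX q .t12)
  | .t22 => -tX q .t11

theorem rels_starHomX : RelsX q (fun g => toConj (starGenX q g)) := by
  have hs := sq_ne_zero q
  constructor <;> simp only [starGenX, toConj_mul, toConj_sub, toConj_one, smul_toConj, map_sub,
    map_inv₀, conj_qc, smul_mul_assoc, mul_smul_comm, smul_smul, mul_neg, neg_mul, neg_neg, smul_neg,
    tX_r1, tX_r2, tX_r3, tX_r4, tX_r5, tX_r6, tX_r7] <;>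
    refine congrArg toConj ?_ <;>
    (match_scalars <;> (try simp only [qc_eq]) <;> (try field_simp) <;> try ring)

/-- The involution as a homomorphism to the conjugate opposite algebra. -/
def starHomX : PolX q →ₐ[ℂ] ConjOp (PolX q) :=
  liftX q (fun g => toConj (starGenX q g)) (rels_starHomX q)

/-- The involution of `Pol(X̃)_q`. -/
def starX (a : PolX q) : PolX q := ofConj (starHomX q a)

/-- Weights of the generators: `H t_{i1} = t_{i1}`, `H t_{i2} = -t_{i2}`. -/
def wtX : GenX → ℂ
  | .t11 => 1
  | .t12 => -1
  | .t21 => 1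
  | .t22 => -1

/-- `K t = kX t • t` on generators: `K = q^{-H/2}`. -/
def kX : GenX → ℂ
  | .t11 => (sq q)⁻¹
  | .t12 => sq q
  | .t21 => (sq q)⁻¹
  | .t22 => sq q

/-- `X⁺ t_{i1} = 0`, `X⁺ t_{i2} = t_{i1}`. -/
def xpX : GenX → PolX q
  | .t11 => 0
  | .t12 => tX q .t11
  | .t21 => 0
  | .t22 => tX q .t21

/-- `X⁻ t_{i1} = t_{i2}`, `X⁻ t_{i2} = 0`. -/
def xmX : GenX → PolX q
  | .t11 => tX q .t12
  | .t12 => 0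
  | .t21 => tX q .t22
  | .t22 => 0

theorem rels_KHomX : RelsX q (fun g => kX q g • tX q g) := by
  have hs := sq_ne_zero q
  constructor <;> simp only [kX, smul_mul_assoc, mul_smul_comm, smul_smul, mul_neg, neg_mul, neg_neg, smul_neg,
    tX_r1, tX_r2, tX_r3, tX_r4, tX_r5, tX_r6, tX_r7] <;>
    (match_scalars <;> (try simp only [qc_eq]) <;> (try field_simp) <;> try ring)

/-- The automorphism `K`. -/
def KHomX : PolX q →ₐ[ℂ] PolX q :=
  liftX q (fun g => kX q g • tX q g) (rels_KHomX q)

theorem rels_KinvHomX : RelsX q (fun g => (kX q g)⁻¹ • tX q g) := by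
  have hs := sq_ne_zero q
  constructor <;> simp only [kX, smul_mul_assoc, mul_smul_comm, smul_smul, mul_neg, neg_mul, neg_neg, smul_neg,
    tX_r1, tX_r2, tX_r3, tX_r4, tX_r5, tX_r6, tX_r7] <;>
    (match_scalars <;> (try simp only [qc_eq]) <;> (try field_simp) <;> try ring)

/-- The automorphism `K⁻¹`. -/
def KinvHomX : PolX q →ₐ[ℂ] PolX q :=
  liftX q (fun g => (kX q g)⁻¹ • tX q g) (rels_KinvHomX q)

theorem rels_HHomX : RelsX q (fun g => tri (tX q g) (wtX g • tX q g) (tX q g)) := by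
  have hs := sq_ne_zero q
  constructor <;> simp only [tri_mul, tri_sub, tri_smul, tri_one, kX, wtX, xpX, xmX,
    mul_zero, zero_mul, add_zero, zero_add, smul_zero, sub_zero,
    smul_mul_assoc, mul_smul_comm, smul_smul, mul_neg, neg_mul, neg_neg, smul_neg,
    tX_r1, tX_r2, tX_r3, tX_r4, tX_r5, tX_r6, tX_r7] <;>
    refine tri_congr ?_ ?_ ?_ <;>
    (match_scalars <;> (try simp only [qc_eq]) <;> (try field_simp) <;> try ring)

/-- The derivation `H`, encoded as `a ↦ !![a, H a; 0, a]`. -/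
def HHomX : PolX q →ₐ[ℂ] Matrix (Fin 2) (Fin 2) (PolX q) :=
  liftX q (fun g => tri (tX q g) (wtX g • tX q g) (tX q g)) (rels_HHomX q)

theorem rels_XpHomX : RelsX q (fun g => tri ((kX q g)⁻¹ • tX q g) (xpX q g) (kX q g • tX q g)) := by
  have hs := sq_ne_zero q
  constructor <;> simp only [tri_mul, tri_sub, tri_smul, tri_one, kX, wtX, xpX, xmX,
    mul_zero, zero_mul, add_zero, zero_add, smul_zero, sub_zero,
    smul_mul_assoc, mul_smul_comm, smul_smul, mul_neg, neg_mul, neg_neg, smul_neg,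
    tX_r1, tX_r2, tX_r3, tX_r4, tX_r5, tX_r6, tX_r7] <;>
    refine tri_congr ?_ ?_ ?_ <;>
    (match_scalars <;> (try simp only [qc_eq]) <;> (try field_simp) <;> try ring)

/-- The twisted derivation `X⁺`, encoded as `a ↦ !![K⁻¹ a, X⁺ a; 0, K a]`. -/
def XpHomX : PolX q →ₐ[ℂ] Matrix (Fin 2) (Fin 2) (PolX q) :=
  liftX q (fun g => tri ((kX q g)⁻¹ • tX q g) (xpX q g) (kX q g • tX q g)) (rels_XpHomX q)

theorem rels_XmHomX : RelsX q (fun g => tri ((kX q g)⁻¹ • tX q g) (xmX q g) (kX q g • tX q g)) := by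
  have hs := sq_ne_zero q
  constructor <;> simp only [tri_mul, tri_sub, tri_smul, tri_one, kX, wtX, xpX, xmX,
    mul_zero, zero_mul, add_zero, zero_add, smul_zero, sub_zero,
    smul_mul_assoc, mul_smul_comm, smul_smul, mul_neg, neg_mul, neg_neg, smul_neg,
    tX_r1, tX_r2, tX_r3, tX_r4, tX_r5, tX_r6, tX_r7] <;>
    refine tri_congr ?_ ?_ ?_ <;>
    (match_scalars <;> (try simp only [qc_eq]) <;> (try field_simp) <;> try ring)

/-- The twisted derivation `X⁻`, encoded as `a ↦ !![K⁻¹ a, X⁻ a; 0, K a]`. -/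
def XmHomX : PolX q →ₐ[ℂ] Matrix (Fin 2) (Fin 2) (PolX q) :=
  liftX q (fun g => tri ((kX q g)⁻¹ • tX q g) (xmX q g) (kX q g • tX q g)) (rels_XmHomX q)

/-- The action of the generators of `U_q su(1,1)` on `Pol(X̃)_q`. -/
def actX : UqGen → PolX q → PolX q
  | .H, a => HHomX q a 0 1
  | .K, a => KHomX q a
  | .Kinv, a => KinvHomX q a
  | .Xp, a => XpHomX q a 0 1
  | .Xm, a => XmHomX q a 0 1

/-- The scalars by which `i_φ` multiplies the generators. -/
def phaseX (φ : ℝ) : GenX → ℂ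
  | .t11 => Complex.exp (φ * Complex.I)
  | .t12 => Complex.exp (φ * Complex.I)
  | .t21 => Complex.exp (-(φ * Complex.I))
  | .t22 => Complex.exp (-(φ * Complex.I))

theorem rels_rotX (φ : ℝ) : RelsX q (fun g => phaseX φ g • tX q g) := by
  have hs := sq_ne_zero q
  have he := Complex.exp_ne_zero (φ * Complex.I)
  constructor <;> simp only [phaseX, Complex.exp_neg, smul_mul_assoc, mul_smul_comm, smul_smul, mul_neg, neg_mul, neg_neg, smul_neg,
    tX_r1, tX_r2, tX_r3, tX_r4, tX_r5, tX_r6, tX_r7] <;>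
    (match_scalars <;> (try simp only [qc_eq]) <;> (try field_simp) <;> try ring)

/-- The one-parameter group `i_φ` of automorphisms of `Pol(X̃)_q`. -/
def rotX (φ : ℝ) : PolX q →ₐ[ℂ] PolX q :=
  liftX q (fun g => phaseX φ g • tX q g) (rels_rotX q φ)

end StructX

/-! ### The algebra of polynomials on the quantum complex plane -/

/-- The generators `z`, `z*` of `Pol(ℂ)_q`. -/
inductive GenU
  | z | zs

open FreeAlgebra in
/-- The defining relation `z* z = q² z z* + 1 - q²` of `Pol(ℂ)_q`. -/
inductive RelU (q : Param) : FreeAlgebra ℂ GenU → FreeAlgebra ℂ GenU → Prop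
  | r : RelU q (ι ℂ .zs * ι ℂ .z) (qc q ^ 2 • (ι ℂ .z * ι ℂ .zs) + (1 - qc q ^ 2) • 1)

/-- The algebra `Pol(ℂ)_q`. -/
def PolU (q : Param) : Type := RingQuot (RelU q)

instance (q : Param) : Ring (PolU q) := inferInstanceAs (Ring (RingQuot (RelU q)))

instance (q : Param) : Algebra ℂ (PolU q) := inferInstanceAs (Algebra ℂ (RingQuot (RelU q)))

/-- The quotient map onto `Pol(ℂ)_q`. -/
def mkU (q : Param) : FreeAlgebra ℂ GenU →ₐ[ℂ] PolU q := RingQuot.mkAlgHom ℂ (RelU q)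

theorem mkU_rel (q : Param) {a b : FreeAlgebra ℂ GenU} (h : RelU q a b) : mkU q a = mkU q b :=
  RingQuot.mkAlgHom_rel ℂ h

/-- The image of a generator in `Pol(ℂ)_q`. -/
def gU (q : Param) (g : GenU) : PolU q := mkU q (FreeAlgebra.ι ℂ g)

theorem gU_r (q : Param) :
    gU q .zs * gU q .z = qc q ^ 2 • (gU q .z * gU q .zs) + (1 - qc q ^ 2) • 1 := by
  have h := mkU_rel q .r
  simp only [map_mul, map_add, map_smul, map_one] at h
  exact h

/-- Extension of an assignment on generators to an algebra homomorphism on `Pol(ℂ)_q`. -/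
def liftU (q : Param) {B : Type} [Ring B] [Algebra ℂ B] (g : GenU → B)
    (h : g .zs * g .z = qc q ^ 2 • (g .z * g .zs) + (1 - qc q ^ 2) • 1) : PolU q →ₐ[ℂ] B :=
  RingQuot.liftAlgHom ℂ ⟨FreeAlgebra.lift ℂ g, by
    intro a b hab
    cases hab
    simpa using h⟩

theorem tri_add {A : Type} [Ring A] (a d b a' d' b' : A) :
    tri a d b + tri a' d' b' = tri (a + a') (d + d') (b + b') := by
  simp [tri]

section StructU

set_option linter.unusedSimpArgs false

variable (q : Param)

/-- The values of the involution: `z ↦ z*`, `z* ↦ z`. -/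
def starGenU : GenU → PolU q
  | .z => gU q .zs
  | .zs => gU q .z

/-- The involution as a homomorphism to the conjugate opposite algebra. -/
def starHomU : PolU q →ₐ[ℂ] ConjOp (PolU q) :=
  liftU q (fun g => toConj (starGenU q g)) (by
    simp only [starGenU, toConj_mul, toConj_one, smul_toConj, toConj_add, map_sub, map_one,
      map_pow, conj_qc, gU_r])

/-- The involution of `Pol(ℂ)_q`. -/
def starU (a : PolU q) : PolU q := ofConj (starHomU q a)

/-- Weights of the generators: `H z = 2 z`, `H z* = -2 z*`. -/
def wtU : GenU → ℂ
  | .z => 2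
  | .zs => -2

/-- `K z = q⁻¹ z`, `K z* = q z*`. -/
def kU : GenU → ℂ
  | .z => (qc q)⁻¹
  | .zs => qc q

/-- `X⁺ z = -q^{-1/2} z²`, `X⁺ z* = q^{-1/2}`. -/
def xpU : GenU → PolU q
  | .z => -((sq q)⁻¹ • (gU q .z * gU q .z))
  | .zs => (sq q)⁻¹ • 1

/-- `X⁻ z = q^{1/2}`, `X⁻ z* = -q^{1/2} z*²`. -/
def xmU : GenU → PolU q
  | .z => sq q • 1
  | .zs => -(sq q • (gU q .zs * gU q .zs))

theorem gU_r_left (a : PolU q) : gU q .zs * (gU q .z * a)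
    = qc q ^ 2 • (gU q .z * (gU q .zs * a)) + (1 - qc q ^ 2) • a := by
  rw [← mul_assoc, gU_r]
  simp only [add_mul, smul_mul_assoc, one_mul, mul_assoc]

/-- The automorphism `K`. -/
def KHomU : PolU q →ₐ[ℂ] PolU q :=
  liftU q (fun g => kU q g • gU q g) (by
    have hs := sq_ne_zero q
    simp only [kU, smul_mul_assoc, mul_smul_comm, gU_r]
    match_scalars <;> (try simp only [qc_eq]) <;> (try field_simp))

/-- The automorphism `K⁻¹`. -/
def KinvHomU : PolU q →ₐ[ℂ] PolU q :=
  liftU q (fun g => (kU q g)⁻¹ • gU q g) (by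
    have hs := sq_ne_zero q
    simp only [kU, smul_mul_assoc, mul_smul_comm, gU_r]
    match_scalars <;> (try simp only [qc_eq]) <;> (try field_simp))

/-- The derivation `H`, encoded as `a ↦ !![a, H a; 0, a]`. -/
def HHomU : PolU q →ₐ[ℂ] Matrix (Fin 2) (Fin 2) (PolU q) :=
  liftU q (fun g => tri (gU q g) (wtU g • gU q g) (gU q g)) (by
    have hs := sq_ne_zero q
    simp only [tri_mul, tri_smul, tri_add, tri_one, wtU, smul_mul_assoc, mul_smul_comm, gU_r]
    refine tri_congr ?_ ?_ ?_ <;>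
    (match_scalars <;> (try simp only [qc_eq]) <;> (try field_simp) <;> try ring))

/-- The twisted derivation `X⁺`, encoded as `a ↦ !![K⁻¹ a, X⁺ a; 0, K a]`. -/
def XpHomU : PolU q →ₐ[ℂ] Matrix (Fin 2) (Fin 2) (PolU q) :=
  liftU q (fun g => tri ((kU q g)⁻¹ • gU q g) (xpU q g) (kU q g • gU q g)) (by
    have hs := sq_ne_zero q
    simp only [tri_mul, tri_smul, tri_add, tri_one, kU, xpU, smul_mul_assoc, mul_smul_comm,
      mul_neg, neg_mul, smul_neg, mul_one, one_mul, mul_add, smul_add, smul_zero, mul_assoc,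
      gU_r, gU_r_left]
    refine tri_congr ?_ ?_ ?_ <;>
    (match_scalars <;> (try simp only [qc_eq]) <;> (try field_simp) <;> try ring))

/-- The twisted derivation `X⁻`, encoded as `a ↦ !![K⁻¹ a, X⁻ a; 0, K a]`. -/
def XmHomU : PolU q →ₐ[ℂ] Matrix (Fin 2) (Fin 2) (PolU q) :=
  liftU q (fun g => tri ((kU q g)⁻¹ • gU q g) (xmU q g) (kU q g • gU q g)) (by
    have hs := sq_ne_zero q
    simp only [tri_mul, tri_smul, tri_add, tri_one, kU, xmU, smul_mul_assoc, mul_smul_comm,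
      mul_neg, neg_mul, smul_neg, mul_one, one_mul, mul_add, smul_add, smul_zero, mul_assoc,
      gU_r, gU_r_left]
    refine tri_congr ?_ ?_ ?_ <;>
    (match_scalars <;> (try simp only [qc_eq]) <;> (try field_simp) <;> try ring))

/-- The action of the generators of `U_q su(1,1)` on `Pol(ℂ)_q`. -/
def actU : UqGen → PolU q → PolU q
  | .H, a => HHomU q a 0 1
  | .K, a => KHomU q a
  | .Kinv, a => KinvHomU q a
  | .Xp, a => XpHomU q a 0 1
  | .Xm, a => XmHomU q a 0 1

end StructU

/-! ### Extension by continuity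

Let `c : A → (I → ℂ)` be the coordinate map of an algebra of polynomials `A`: it sends a polynomial
to the family of values of the coefficients of its normal form. The topology of `A` is the weakest
one in which all coordinates are continuous, that is, the one induced by `c` from the topology of
pointwise convergence on `I → ℂ`; the range of `c` is dense, so that `I → ℂ` is the completion. -/

/-- The extension by continuity of a map `T` on polynomials to all distributions:
the value at `F` is the limit of `T a` as the polynomial `a` tends to `F`. -/
def contExt {A I : Type} (c : A → I → ℂ) (T : A → I → ℂ) (F : I → ℂ) : I → ℂ :=
  limUnder (comap c (𝓝 F)) T

/-- The product `a · F` of a polynomial and a distribution. -/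
def polMul {A I : Type} [Ring A] (c : A → I → ℂ) (a : A) (F : I → ℂ) : I → ℂ :=
  contExt c (fun b => c (a * b)) F

/-- The product `F · a` of a distribution and a polynomial. -/
def mulPol {A I : Type} [Ring A] (c : A → I → ℂ) (F : I → ℂ) (a : A) : I → ℂ :=
  contExt c (fun b => c (b * a)) F

/-- The product `F · g` of a distribution `F` and a finite function `g`: the extension by continuity
of `a ↦ a · g` from polynomials to distributions. For finite `F` this is the product of finite
functions. -/
def distMul {A I : Type} [Ring A] (c : A → I → ℂ) (F g : I → ℂ) : I → ℂ :=
  contExt c (fun a => polMul c a g) F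

/-- The product `g · F` of a finite function `g` and a distribution `F`: the extension by continuity
of `a ↦ g · a` from polynomials to distributions. -/
def mulDist {A I : Type} [Ring A] (c : A → I → ℂ) (g F : I → ℂ) : I → ℂ :=
  contExt c (fun a => mulPol c g a) F

/-- The space of finite functions: only finitely many coordinates are non-zero. -/
def finDist (I : Type) : Submodule ℂ (I → ℂ) where
  carrier := {f | f.support.Finite}
  zero_mem' := by simp
  add_mem' := fun {f g} hf hg => (hf.union hg).subset (Function.support_add f g)
  smul_mem' := fun c f hf => hf.subset (Function.support_const_smul_subset c f)

/-! ### Distributions and finite functions in the quantum disc -/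

/-- `y = 1 - z z*`. -/
def yU (q : Param) : PolU q := 1 - gU q .z * gU q .zs

/-- The sum `∑_{j>0} z^j ψ_j(y) + ψ_0(y) + ∑_{j>0} ψ_{-j}(y) z*^j` with polynomial coefficients.
Every element of `Pol(ℂ)_q` is such a sum for exactly one family `ψ`. -/
def sumU (q : Param) (ψ : ℤ →₀ ℂ[X]) : PolU q :=
  ψ.sum fun j p => gU q .z ^ j.toNat * aeval (yU q) p * gU q .zs ^ (-j).toNat

/-- Distributions in the quantum disc: formal series
`∑_{j>0} z^j ψ_j(y) + ψ_0(y) + ∑_{j>0} ψ_{-j}(y) z*^j` whose coefficients are functions on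
`q^{2ℤ₊}`. The entry at `(j, m)` is `ψ_j(q^{2m})`, and the topology is that of pointwise
convergence. -/
abbrev DistU : Type := ℤ × ℕ → ℂ

/-- The coordinates `ψ_j(q^{2m})` of a polynomial. -/
def coordU (q : Param) (f : PolU q) : DistU :=
  fun k => (Function.invFun (sumU q) f k.1).eval (qc q ^ (2 * k.2))

/-- The space `D(U)_q` of finite functions in the quantum disc. -/
abbrev FinU : Submodule ℂ DistU := finDist (ℤ × ℕ)

/-- The action of `U_q su(1,1)` on distributions in the quantum disc. -/
def actDistU (q : Param) (ξ : UqGen) : DistU → DistU :=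
  contExt (coordU q) (fun a => coordU q (actU q ξ a))

/-- The involution on distributions in the quantum disc. -/
def starDistU (q : Param) : DistU → DistU :=
  contExt (coordU q) (fun a => coordU q (starU q a))

/-- `f₀ = ψ_0(y)`, where `ψ_0(1) = 1` and `ψ_0(y) = 0` for `y ∈ {q², q⁴, …}`: the projection
with `z* f₀ = f₀ z = 0`, `f₀ f₀ = f₀`. -/
def f0 : FinU :=
  ⟨fun k => if k.1 = 0 ∧ k.2 = 0 then 1 else 0,
    (Set.finite_singleton ((0, 0) : ℤ × ℕ)).subset fun k hk => by
      simp only [Function.mem_support, ne_eq, ite_eq_right_iff, not_forall] at hk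
      exact Prod.ext hk.1.1 hk.1.2⟩

/-! ### Distributions and finite functions on the quantum homogeneous spaces -/

/-- The index set `M'' = {(i₁, i₂, j₁, j₂) ∈ ℤ₊⁴ | i₁ j₁ = i₂ j₂ = 0}`. -/
structure MIdx where
  i₁ : ℕ
  i₂ : ℕ
  j₁ : ℕ
  j₂ : ℕ
  h₁ : i₁ * j₁ = 0
  h₂ : i₂ * j₂ = 0

/-- `x = t₁₂ t₁₂*`. -/
def xX (q : Param) : PolX q := tX q .t12 * starX q (tX q .t12)

/-- The sum `∑ t₁₁^{i₁} t₁₂^{i₂} ψ_{i₁i₂j₁j₂}(x) t₁₂*^{j₂} t₁₁*^{j₁}` over `M''` with polynomial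
coefficients. Every element of `Pol(X̃)_q` is such a sum for exactly one family `ψ`. -/
def sumX (q : Param) (ψ : MIdx →₀ ℂ[X]) : PolX q :=
  ψ.sum fun μ p => tX q .t11 ^ μ.i₁ * tX q .t12 ^ μ.i₂ * aeval (xX q) p *
    starX q (tX q .t12) ^ μ.j₂ * starX q (tX q .t11) ^ μ.j₁

/-- Distributions on the quantum principal homogeneous space `X̃`: formal series
`∑ t₁₁^{i₁} t₁₂^{i₂} ψ_{i₁i₂j₁j₂}(x) t₁₂*^{j₂} t₁₁*^{j₁}` over `M''` whose coefficients are
functions on `q^{-2ℤ₊}`. The entry at `(μ, m)` is `ψ_μ(q^{-2m})`, and the topology is that of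
pointwise convergence. -/
abbrev DistXt : Type := MIdx × ℕ → ℂ

/-- The coordinates `ψ_μ(q^{-2m})` of a polynomial. -/
def coordX (q : Param) (f : PolX q) : DistXt :=
  fun k => (Function.invFun (sumX q) f k.1).eval ((qc q)⁻¹ ^ (2 * k.2))

/-- The action of `U_q su(1,1)` on distributions on `X̃`. -/
def actDistX (q : Param) (ξ : UqGen) : DistXt → DistXt :=
  contExt (coordX q) (fun a => coordX q (actX q ξ a))

/-- The involution on distributions on `X̃`. -/
def starDistX (q : Param) : DistXt → DistXt :=
  contExt (coordX q) (fun a => coordX q (starX q a))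

/-- The operators `i_φ` on distributions on `X̃`. -/
def rotDistX (q : Param) (φ : ℝ) : DistXt → DistXt :=
  contExt (coordX q) (fun a => coordX q (rotX q φ a))

/-- `e₀ = ψ_{0000}(x)`, where `ψ_{0000}(1) = 1` and `ψ_{0000}(x) = 0` for `x ∈ {q⁻², q⁻⁴, …}`. -/
def e0 : DistXt := fun k =>
  if k.1.i₁ = 0 ∧ k.1.i₂ = 0 ∧ k.1.j₁ = 0 ∧ k.1.j₂ = 0 ∧ k.2 = 0 then 1 else 0

/-- The space `D(X)'_q` of distributions on the quantum homogeneous space `X`: the invariants of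
the group `i_φ` in the distributions on `X̃`. -/
def DistX (q : Param) : Type := {f : DistXt // ∀ φ : ℝ, rotDistX q φ f = f}

instance (q : Param) : TopologicalSpace (DistX q) :=
  inferInstanceAs (TopologicalSpace {f : DistXt // ∀ φ : ℝ, rotDistX q φ f = f})

/-- The space `D(X)_q` of finite functions on the quantum homogeneous space `X`: the invariants of
the group `i_φ` in the finite functions on `X̃`. -/
def FinX (q : Param) : Type :=
  {f : DistXt // f ∈ finDist (MIdx × ℕ) ∧ ∀ φ : ℝ, rotDistX q φ f = f}

/-! ### Morphisms -/

/-- The bijection `i : D(U)_q → D(X)_q` is an isomorphism of covariant `*`-algebras: it is linear,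
multiplicative, commutes with the involutions and with the action of `U_q su(1,1)`. The existential
quantifiers say that the product, the involution and the action do not leave `D(U)_q`. -/
structure IsCovariantStarIso (q : Param) (i : FinU ≃ FinX q) : Prop where
  map_add : ∀ f g : FinU, (i (f + g)).1 = (i f).1 + (i g).1
  map_smul : ∀ (c : ℂ) (f : FinU), (i (c • f)).1 = c • (i f).1
  map_mul : ∀ f g : FinU, ∃ h : FinU, h.1 = distMul (coordU q) f.1 g.1 ∧
    (i h).1 = distMul (coordX q) (i f).1 (i g).1
  map_star : ∀ f : FinU, ∃ h : FinU, h.1 = starDistU q f.1 ∧ (i h).1 = starDistX q (i f).1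
  map_act : ∀ (ξ : UqGen) (f : FinU), ∃ h : FinU, h.1 = actDistU q ξ f.1 ∧
    (i h).1 = actDistX q ξ (i f).1

/-- The homeomorphism `j : D(U)'_q → D(X)'_q` is an isomorphism of `U_q su(1,1)`-modules. -/
structure IsModuleIso (q : Param) (j : DistU ≃ₜ DistX q) : Prop where
  map_add : ∀ F G : DistU, (j (F + G)).1 = (j F).1 + (j G).1
  map_smul : ∀ (c : ℂ) (F : DistU), (j (c • F)).1 = c • (j F).1
  map_act : ∀ (ξ : UqGen) (F : DistU), (j (actDistU q ξ F)).1 = actDistX q ξ (j F).1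

/-- The map `j` of distributions agrees, along the map `i` of finite functions, with the structure
of a `D(U)_q`-bimodule on `D(U)'_q` and that of a `D(X)_q`-bimodule on `D(X)'_q`. -/
def AgreesWithBimodules (q : Param) (i : FinU ≃ FinX q) (j : DistU ≃ₜ DistX q) : Prop :=
  ∀ (g : FinU) (F : DistU),
    (j (mulDist (coordU q) g.1 F)).1 = mulDist (coordX q) (i g).1 (j F).1 ∧
    (j (distMul (coordU q) F g.1)).1 = distMul (coordX q) (j F).1 (i g).1

/-- The distribution `w` is inverse to the polynomial `t`. -/
def IsInverseX (q : Param) (t : PolX q) (w : DistXt) : Prop :=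
  polMul (coordX q) t w = coordX q 1 ∧ mulPol (coordX q) w t = coordX q 1

end QDisc

end

noncomputable section

namespace QDisc

/-! Both algebras are algebras of infinite matrices. In the disc let z be the shift e_m ↦ e_{m+1}
and let z* send e_m to (1 - q^{2m}) e_{m-1}; then y is diagonal with eigenvalues q^{2m}. A normally
ordered term with index j lives on one diagonal, and ψ_j(q^{2m}) is, up to a non-zero factor, the
entry at (m + j⁺, m + j⁻). Hence D(U)'_q is the space of all matrices with entrywise convergence,
and D(U)_q consists of those with finitely many non-zero entries (`realU`). On X̃ the elements t₁₁,
t₂₂ are weighted shifts, t₁₂, t₂₁ are invertible diagonal matrices, and x has eigenvalues q^{-2m};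
each entry also carries a degree in ℤ, the character by which i_φ acts on it (`realX`).

In both pictures the structure is given by the same formulas: H grades the entries, X^± are twisted
commutators with z and z*, the involution is the adjoint for the norms that make z* adjoint to z,
and the product is that of matrices. Invariance under all i_φ means degree 0. The isomorphism
therefore just puts an ungraded matrix in degree 0 (`inclZero`). Both f₀ and e₀ are the matrix unit
E₀₀, and the formulas for z and z* are identities between weighted shifts.

Operations on distributions are defined as limits over polynomials. Since polynomials are dense
(`denseRange_evalFamily`), it suffices to exhibit a continuous operator on matrices that is correct
on polynomials (`contExt_eq`). A polynomial a corresponds to the matrix a · 1, so correctness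
reduces to an intertwining relation on generators (`Realization.act_of_shifts`,
`Realization.star_of_generators`). The coordinates make sense because normal forms exist and are
unique: uniqueness is read off the matrix entries, existence comes from q-commutation
(`sumU_surjective`, `sumX_surjective`).

The isomorphism is unique because f₀ generates D(U)_q (`mem_of_closed`): X⁺ takes E_{n0} to a
non-zero multiple of E_{n+1,0}, the involution yields E_{0n}, and E_{a0} E_{0b} = E_{ab}. The
continuous extension is unique because finite functions are dense. -/

/-! ### Weighted composition operators -/

/-- The operator `F ↦ (p ↦ w p * F (σ p))`. -/
def wcomp {P Q : Type} (w : P → ℂ) (σ : P → Q) : (Q → ℂ) →L[ℂ] (P → ℂ) where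
  toFun F := fun p => w p * F (σ p)
  map_add' F G := by funext p; simp [mul_add]
  map_smul' c F := by funext p; simp [mul_left_comm]
  cont := by fun_prop

@[simp] theorem wcomp_apply {P Q : Type} (w : P → ℂ) (σ : P → Q) (F : Q → ℂ) (p : P) :
    wcomp w σ F p = w p * F (σ p) := rfl

/-- Reindexing and rescaling by non-zero factors. -/
def rescale {I P : Type} (e : I ≃ P) (w : I → ℂ) (hw : ∀ k, w k ≠ 0) :
    (I → ℂ) ≃L[ℂ] (P → ℂ) :=
  ContinuousLinearEquiv.equivOfInverse (wcomp (fun p => w (e.symm p)) e.symm)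
    (wcomp (fun k => (w k)⁻¹) e)
    (fun F => by funext k; simp [hw])
    (fun F => by funext p; simp [hw])

theorem rescale_apply {I P : Type} (e : I ≃ P) (w : I → ℂ) (hw : ∀ k, w k ≠ 0) (F : I → ℂ)
    (k : I) : rescale e w hw F (e k) = w k * F k := by
  change w (e.symm (e k)) * F (e.symm (e k)) = _
  simp

theorem finite_support_rescale {I P : Type} (e : I ≃ P) (w : I → ℂ) (hw : ∀ k, w k ≠ 0)
    (F : I → ℂ) : (rescale e w hw F).support.Finite ↔ F.support.Finite := by
  have h : (rescale e w hw F).support = e '' F.support := by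
    ext p
    obtain ⟨k, rfl⟩ := e.surjective p
    simp [rescale_apply, hw]
  rw [h, Set.finite_image_iff e.injective.injOn]

/-! ### Extension by continuity -/

/-- Density makes the filter of polynomials tending to `F` non-trivial, and along it `S ∘ c` tends
to `S F`. The limit in the definition of `contExt` is thus a genuine one and not a default value. -/
theorem contExt_eq {A I : Type} {c : A → I → ℂ} (hc : DenseRange c) {T : A → I → ℂ}
    {S : (I → ℂ) → I → ℂ} (hS : Continuous S) (h : ∀ a, T a = S (c a)) (F : I → ℂ) :
    contExt c T F = S F := by
  have : NeBot (comap c (𝓝 F)) := by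
    refine comap_neBot fun t ht => ?_
    obtain ⟨_, h, a, rfl⟩ := mem_closure_iff_nhds.1 (hc F) t ht
    exact ⟨a, h⟩
  have hT : T = S ∘ c := funext h
  refine Tendsto.limUnder_eq ?_
  rw [hT]
  exact (hS.tendsto F).comp tendsto_comap

/-- Coefficientwise evaluation of families of polynomials at infinitely many points has dense
range. -/
theorem denseRange_evalFamily {ι : Type} {x : ℕ → ℂ} (hx : Function.Injective x) :
    DenseRange fun (ψ : ι →₀ ℂ[X]) (k : ι × ℕ) => (ψ k.1).eval (x k.2) := by
  classical
  intro F
  rw [mem_closure_iff_nhds]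
  intro U hU
  rw [nhds_pi, Filter.mem_pi'] at hU
  obtain ⟨s, t, ht, hst⟩ := hU
  -- A neighbourhood in the product topology constrains finitely many coordinates, all with `m < N`;
  -- interpolation at the first `N` nodes matches them exactly.
  let N := s.sup (fun k => k.2) + 1
  let ψ : ι →₀ ℂ[X] := Finsupp.onFinset (s.image Prod.fst)
    (fun i => if i ∈ s.image Prod.fst then
      Lagrange.interpolate (Finset.range N) x (fun m => F (i, m)) else 0)
    (fun i hi => by by_contra h; simp [h] at hi)
  refine ⟨_, hst ?_, ψ, rfl⟩
  intro k hk
  have h1 : k.1 ∈ s.image Prod.fst := Finset.mem_image_of_mem _ hk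
  have h2 : k.2 ∈ Finset.range N :=
    Finset.mem_range.2 (Nat.lt_succ_of_le (Finset.le_sup (f := fun k : ι × ℕ => k.2) hk))
  have h3 : (ψ k.1).eval (x k.2) = F k := by
    change (if k.1 ∈ s.image Prod.fst then _ else (0 : ℂ[X])).eval _ = _
    rw [if_pos h1, Lagrange.eval_interpolate_at_node _ hx.injOn h2]
  change (ψ k.1).eval (x k.2) ∈ t k
  rw [h3]
  exact mem_of_mem_nhds (ht k)

/-- Finite functions are dense in the space of all functions. -/
theorem dense_finDist (I : Type) : Dense (finDist I : Set (I → ℂ)) := by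
  classical
  intro F
  rw [mem_closure_iff_nhds]
  intro U hU
  rw [nhds_pi, Filter.mem_pi'] at hU
  obtain ⟨s, t, ht, hst⟩ := hU
  refine ⟨fun k => if k ∈ s then F k else 0, hst fun k hk => ?_, ?_⟩
  · simpa [Finset.mem_coe.1 hk] using mem_of_mem_nhds (ht k)
  · refine s.finite_toSet.subset fun k hk => ?_
    by_contra h
    simp_all

/-! ### Intertwiners -/

/-- An element that intertwines two homomorphisms on generators intertwines them. -/
theorem intertwine_of_generators {A B G : Type} [Ring A] [Algebra ℂ A] [Ring B] [Algebra ℂ B]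
    {t : G → A} (ht : Algebra.adjoin ℂ (Set.range t) = ⊤) {ρ τ : A →ₐ[ℂ] B} {P : B}
    (h : ∀ g, P * ρ (t g) = τ (t g) * P) (a : A) : P * ρ a = τ a * P := by
  have ha : a ∈ Algebra.adjoin ℂ (Set.range t) := ht ▸ Algebra.mem_top
  induction ha using Algebra.adjoin_induction with
  | mem x hx => obtain ⟨g, rfl⟩ := hx; exact h g
  | algebraMap r => simp [Algebra.commutes]
  | add x y _ _ hx hy => rw [map_add, map_add, mul_add, add_mul, hx, hy]
  | mul x y _ _ hx hy => rw [map_mul, map_mul, ← mul_assoc, hx, mul_assoc, hy, mul_assoc]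

/-! ### Kernels -/

/-- Infinite matrices with entries graded by `Γ`. -/
abbrev Ker (Γ : Type) : Type := ℕ × ℕ × Γ → ℂ

section Kernels

variable {Γ : Type} [AddCommGroup Γ]

/-- Left multiplication by a matrix of degree `β` with one entry per row. -/
def lop (w : ℕ → ℂ) (σ : ℕ → ℕ) (β : Γ) : Ker Γ →L[ℂ] Ker Γ :=
  wcomp (fun p => w p.1) (fun p => (σ p.1, p.2.1, p.2.2 - β))

/-- Right multiplication by a matrix of degree `β` with one entry per column. -/
def rop (w : ℕ → ℂ) (σ : ℕ → ℕ) (β : Γ) : Ker Γ →L[ℂ] Ker Γ :=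
  wcomp (fun p => w p.2.1) (fun p => (p.1, σ p.2.1, p.2.2 - β))

theorem lop_apply (w : ℕ → ℂ) (σ : ℕ → ℕ) (β : Γ) (F : Ker Γ) (r s : ℕ) (b : Γ) :
    lop w σ β F (r, s, b) = w r * F (σ r, s, b - β) := rfl

theorem rop_apply (w : ℕ → ℂ) (σ : ℕ → ℕ) (β : Γ) (F : Ker Γ) (r s : ℕ) (b : Γ) :
    rop w σ β F (r, s, b) = w s * F (r, σ s, b - β) := rfl

/-- This is associativity of the matrix product: one operator touches rows, the other columns. -/
theorem lop_rop_comm (w w' : ℕ → ℂ) (σ σ' : ℕ → ℕ) (β β' : Γ) :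
    lop w σ β * rop w' σ' β' = rop w' σ' β' * lop w σ β := by
  refine ContinuousLinearMap.ext fun F => funext fun ⟨r, s, b⟩ => ?_
  simp [lop_apply, rop_apply, mul_left_comm, sub_right_comm]

/-- Powers of a shift to the preceding row. -/
theorem lop_pred_pow (w : ℕ → ℂ) (β : Γ) (n : ℕ) (F : Ker Γ) (r s : ℕ) (b : Γ) :
    (lop w Nat.pred β ^ n) F (r, s, b)
      = (∏ i ∈ Finset.range n, w (r - i)) * F (r - n, s, b - n • β) := by
  induction n generalizing F with
  | zero => simp
  | succ n ih =>
    rw [pow_succ, mul_apply_eq_comp, ih, lop_apply, Finset.prod_range_succ, mul_assoc,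
      sub_sub, ← succ_nsmul, Nat.pred_eq_sub_one, Nat.sub_sub]

theorem rop_pred_pow (w : ℕ → ℂ) (β : Γ) (n : ℕ) (F : Ker Γ) (r s : ℕ) (b : Γ) :
    (rop w Nat.pred β ^ n) F (r, s, b)
      = (∏ i ∈ Finset.range n, w (s - i)) * F (r, s - n, b - n • β) := by
  induction n generalizing F with
  | zero => simp
  | succ n ih =>
    rw [pow_succ, mul_apply_eq_comp, ih, rop_apply, Finset.prod_range_succ, mul_assoc,
      sub_sub, ← succ_nsmul, Nat.pred_eq_sub_one, Nat.sub_sub]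

theorem lop_id_pow (w : ℕ → ℂ) (β : Γ) (n : ℕ) (F : Ker Γ) (r s : ℕ) (b : Γ) :
    (lop w id β ^ n) F (r, s, b) = w r ^ n * F (r, s, b - n • β) := by
  induction n generalizing F with
  | zero => simp
  | succ n ih =>
    rw [pow_succ, mul_apply_eq_comp, ih, lop_apply, pow_succ, mul_assoc,
      sub_sub, ← succ_nsmul, id]

theorem rop_id_pow (w : ℕ → ℂ) (β : Γ) (n : ℕ) (F : Ker Γ) (r s : ℕ) (b : Γ) :
    (rop w id β ^ n) F (r, s, b) = w s ^ n * F (r, s, b - n • β) := by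
  induction n generalizing F with
  | zero => simp
  | succ n ih =>
    rw [pow_succ, mul_apply_eq_comp, ih, rop_apply, pow_succ, mul_assoc,
      sub_sub, ← succ_nsmul, id]

/-- For `n > r` the factor with `i = r` is `w 0 = 0`. This removes the spurious entries that
truncated subtraction leaves in `lop_pred_pow` and `rop_pred_pow`. -/
theorem prod_shift_ne_zero_iff {w : ℕ → ℂ} (hw : ∀ r, w r = 0 ↔ r = 0) (n r : ℕ) :
    ∏ i ∈ Finset.range n, w (r - i) ≠ 0 ↔ n ≤ r := by
  simp only [ne_eq, Finset.prod_eq_zero_iff, Finset.mem_range, hw, not_exists, not_and]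
  constructor
  · intro h
    by_contra hn
    exact h r (by omega) (by omega)
  · intro h i hi
    omega

theorem aeval_lop_diag (d : ℕ → ℂ) (p : ℂ[X]) :
    aeval (lop d id (0 : Γ)) p = lop (fun r => p.eval (d r)) id 0 := by
  induction p using Polynomial.induction_on' with
  | add p p' h h' =>
    refine ContinuousLinearMap.ext fun F => funext fun ⟨r, s, b⟩ => ?_
    simp [h, h', lop_apply, add_mul]
  | monomial n a =>
    refine ContinuousLinearMap.ext fun F => funext fun ⟨r, s, b⟩ => ?_
    rw [aeval_monomial, Algebra.algebraMap_eq_smul_one, smul_mul_assoc, one_mul, smul_apply,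
      Pi.smul_apply, lop_id_pow, lop_apply]
    simp [mul_assoc]

open Classical in
/-- The identity matrix. -/
def oneKer (Γ : Type) [AddCommGroup Γ] : Ker Γ := fun p => if p.1 = p.2.1 ∧ p.2.2 = 0 then 1 else 0

open Classical in
/-- Left multiplication by a matrix unit. -/
def lunit (p : ℕ × ℕ × Γ) : Ker Γ →L[ℂ] Ker Γ :=
  lop (fun r => if r = p.1 then 1 else 0) (fun _ => p.2.1) p.2.2

open Classical in
/-- Right multiplication by a matrix unit. -/
def runit (p : ℕ × ℕ × Γ) : Ker Γ →L[ℂ] Ker Γ :=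
  rop (fun s => if s = p.2.1 then 1 else 0) (fun _ => p.1) p.2.2

open Classical in
theorem lunit_one (p : ℕ × ℕ × Γ) : lunit p (oneKer Γ) = Pi.single p 1 := by
  funext ⟨r, s, b⟩
  obtain ⟨r', s', b'⟩ := p
  simp only [lunit, lop_apply, oneKer, sub_eq_zero, Pi.single_apply, Prod.mk.injEq]
  split_ifs <;> simp_all

open Classical in
theorem runit_one (p : ℕ × ℕ × Γ) : runit p (oneKer Γ) = Pi.single p 1 := by
  funext ⟨r, s, b⟩
  obtain ⟨r', s', b'⟩ := p
  simp only [runit, rop_apply, oneKer, sub_eq_zero, Pi.single_apply, Prod.mk.injEq]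
  split_ifs <;> simp_all

/-- Left multiplication by the restriction of a matrix `g` to a finite set of entries. -/
def lmulFin (S : Finset (ℕ × ℕ × Γ)) (g : Ker Γ) : Ker Γ →L[ℂ] Ker Γ := ∑ p ∈ S, g p • lunit p

/-- Right multiplication by the restriction of a matrix `g` to a finite set of entries. -/
def rmulFin (S : Finset (ℕ × ℕ × Γ)) (g : Ker Γ) : Ker Γ →L[ℂ] Ker Γ := ∑ p ∈ S, g p • runit p

open Classical in
theorem sum_single_of_support {P : Type} {S : Finset P} {g : P → ℂ} (h : g.support ⊆ S) :
    ∑ p ∈ S, g p • (Pi.single p 1 : P → ℂ) = g := by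
  funext p
  simp only [Finset.sum_apply, Pi.smul_apply, Pi.single_apply, smul_eq_mul, mul_ite, mul_one,
    mul_zero, Finset.sum_ite_eq]
  split_ifs with hp
  · rfl
  · by_contra h0
    exact hp (h (Ne.symm h0))

theorem lmulFin_one {S : Finset (ℕ × ℕ × Γ)} {g : Ker Γ} (h : g.support ⊆ S) :
    lmulFin S g (oneKer Γ) = g := by
  classical
  simp only [lmulFin, sum_apply, smul_apply, lunit_one]
  convert sum_single_of_support h

theorem rmulFin_one {S : Finset (ℕ × ℕ × Γ)} {g : Ker Γ} (h : g.support ⊆ S) :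
    rmulFin S g (oneKer Γ) = g := by
  classical
  simp only [rmulFin, sum_apply, smul_apply, runit_one]
  convert sum_single_of_support h

end Kernels

/-! ### Realizations of algebras of polynomials by kernels -/

/-- A realization of an algebra with a coordinate map by matrices: left and right multiplication
operators such that the coordinates of `a` are those of the matrix `a · 1 = 1 · a`. -/
structure Realization {A I : Type} [Ring A] [Algebra ℂ A] (c : A → I → ℂ)
    (Γ : Type) [AddCommGroup Γ] where
  toKer : (I → ℂ) ≃L[ℂ] Ker Γ
  L : A →ₐ[ℂ] (Ker Γ →L[ℂ] Ker Γ)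
  R : A →ₐ[ℂ] (Ker Γ →L[ℂ] Ker Γ)ᵐᵒᵖ
  L_comm : ∀ a w σ (β : Γ), rop w σ β * L a = L a * rop w σ β
  R_comm : ∀ a w σ (β : Γ), lop w σ β * (R a).unop = (R a).unop * lop w σ β
  R_one : ∀ a, (R a).unop (oneKer Γ) = L a (oneKer Γ)
  toKer_coord : ∀ a, toKer (c a) = L a (oneKer Γ)
  dense : DenseRange c

namespace Realization

variable {A I Γ : Type} [Ring A] [Algebra ℂ A] [AddCommGroup Γ] {c : A → I → ℂ}
  (ρ : Realization c Γ)

theorem coord_eq (ρ : Realization c Γ) (a : A) : c a = ρ.toKer.symm (ρ.L a (oneKer Γ)) := by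
  rw [← ρ.toKer_coord, ρ.toKer.symm_apply_apply]

theorem contExt_eq {T : A → A} {S : Ker Γ → Ker Γ} (hS : Continuous S)
    (h : ∀ a, ρ.L (T a) (oneKer Γ) = S (ρ.L a (oneKer Γ))) (F : I → ℂ) :
    contExt c (fun a => c (T a)) F = ρ.toKer.symm (S (ρ.toKer F)) := by
  refine QDisc.contExt_eq ρ.dense (S := fun F => ρ.toKer.symm (S (ρ.toKer F)))
    (by fun_prop) (fun a => ?_) F
  rw [ρ.coord_eq, h, ρ.toKer_coord]

theorem polMul_eq (a : A) (F : I → ℂ) :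
    polMul c a F = ρ.toKer.symm (ρ.L a (ρ.toKer F)) :=
  ρ.contExt_eq (S := ρ.L a) (ρ.L a).continuous (fun b => by rw [map_mul]; rfl) F

theorem mulPol_eq (F : I → ℂ) (a : A) :
    mulPol c F a = ρ.toKer.symm ((ρ.R a).unop (ρ.toKer F)) :=
  ρ.contExt_eq (S := (ρ.R a).unop) (ρ.R a).unop.continuous
    (fun b => by rw [← ρ.R_one, ← ρ.R_one, map_mul]; rfl) F

/-- Right multiplication by a finite matrix is a finite combination of right matrix units, hence
continuous and commuting with left multiplications. So a · g = a · (1 · g) = (a · 1) · g, where a ·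
1 is the matrix of a. -/
theorem distMul_eq (F : I → ℂ) {g : I → ℂ} {S : Finset (ℕ × ℕ × Γ)}
    (hg : (ρ.toKer g).support ⊆ S) :
    distMul c F g = ρ.toKer.symm (rmulFin S (ρ.toKer g) (ρ.toKer F)) := by
  refine QDisc.contExt_eq ρ.dense
    (S := fun F => ρ.toKer.symm (rmulFin S (ρ.toKer g) (ρ.toKer F))) (by fun_prop) (fun a => ?_) F
  have hcomm : rmulFin S (ρ.toKer g) * ρ.L a = ρ.L a * rmulFin S (ρ.toKer g) := by
    refine ContinuousLinearMap.ext fun G => ?_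
    simp only [rmulFin, mul_apply_eq_comp, sum_apply, smul_apply, map_sum, map_smul]
    refine Finset.sum_congr rfl fun p _ => congrArg _ ?_
    rw [runit, ← mul_apply_eq_comp, ρ.L_comm, mul_apply_eq_comp]
  have h := DFunLike.congr_fun hcomm (oneKer Γ)
  rw [mul_apply_eq_comp, mul_apply_eq_comp, rmulFin_one hg] at h
  rw [ρ.polMul_eq, ρ.toKer_coord, h]

theorem mulDist_eq {g : I → ℂ} {S : Finset (ℕ × ℕ × Γ)} (hg : (ρ.toKer g).support ⊆ S)
    (F : I → ℂ) :
    mulDist c g F = ρ.toKer.symm (lmulFin S (ρ.toKer g) (ρ.toKer F)) := by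
  refine QDisc.contExt_eq ρ.dense
    (S := fun F => ρ.toKer.symm (lmulFin S (ρ.toKer g) (ρ.toKer F))) (by fun_prop) (fun a => ?_) F
  have hcomm : lmulFin S (ρ.toKer g) * (ρ.R a).unop = (ρ.R a).unop * lmulFin S (ρ.toKer g) := by
    refine ContinuousLinearMap.ext fun G => ?_
    simp only [lmulFin, mul_apply_eq_comp, sum_apply, smul_apply, map_sum, map_smul]
    refine Finset.sum_congr rfl fun p _ => congrArg _ ?_
    rw [lunit, ← mul_apply_eq_comp, ρ.R_comm, mul_apply_eq_comp]
  have h := DFunLike.congr_fun hcomm (oneKer Γ)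
  rw [mul_apply_eq_comp, mul_apply_eq_comp, lmulFin_one hg] at h
  rw [ρ.mulPol_eq, ρ.toKer_coord, ← ρ.R_one, h]

end Realization

/-! ### The symmetry algebra and the involution acting on kernels -/

section Action

variable {Γ : Type} [AddCommGroup Γ] (q : Param) (deg : Γ →+ ℤ)

theorem qc_pow_ne_one (q : Param) {n : ℕ} (hn : n ≠ 0) : 1 - qc q ^ n ≠ 0 := by
  have h : (q : ℝ) ^ n < 1 := pow_lt_one₀ q.2.1.le q.2.2 hn
  have h' : 1 - (q : ℝ) ^ n ≠ 0 := by linarith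
  rw [qc]
  exact_mod_cast h'

theorem qc_ne_zero (q : Param) : qc q ≠ 0 := by
  rw [qc_eq]
  exact pow_ne_zero _ (sq_ne_zero q)

/-- The row weight of the shift `e_m ↦ e_{m+1}`. -/
def shiftWt (r : ℕ) : ℂ := if r = 0 then 0 else 1

@[simp] theorem shiftWt_zero : shiftWt 0 = 0 := rfl

@[simp] theorem shiftWt_succ (r : ℕ) : shiftWt (r + 1) = 1 := rfl

/-- Left multiplication by `z : e_m ↦ e_{m+1}`. -/
def zL (Γ : Type) [AddCommGroup Γ] : Ker Γ →L[ℂ] Ker Γ := lop shiftWt Nat.pred 0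

/-- Right multiplication by `z`. -/
def zR (Γ : Type) [AddCommGroup Γ] : Ker Γ →L[ℂ] Ker Γ := rop (fun _ => 1) Nat.succ 0

/-- Left multiplication by `z* : e_m ↦ (1 - q^{2m}) e_{m-1}`. -/
def zsL (Γ : Type) [AddCommGroup Γ] : Ker Γ →L[ℂ] Ker Γ :=
  lop (fun r => 1 - qc q ^ (2 * (r + 1))) Nat.succ 0

/-- Right multiplication by `z*`. -/
def zsR (Γ : Type) [AddCommGroup Γ] : Ker Γ →L[ℂ] Ker Γ :=
  rop (fun s => 1 - qc q ^ (2 * s)) Nat.pred 0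

/-- Both sides are the matrix of z; this is why X⁺, a twisted commutator with z, annihilates 1. -/
theorem zL_one : zL Γ (oneKer Γ) = zR Γ (oneKer Γ) := by
  classical
  funext ⟨r, s, b⟩
  rcases r with _ | r <;> simp [zL, zR, lop_apply, rop_apply, oneKer]

theorem zsL_one : zsL q Γ (oneKer Γ) = zsR q Γ (oneKer Γ) := by
  classical
  funext ⟨r, s, b⟩
  rcases s with _ | s
  · simp [zsL, zsR, lop_apply, rop_apply, oneKer]
  · simp only [zsL, zsR, lop_apply, rop_apply, oneKer, sub_zero, Nat.succ_eq_add_one,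
      Nat.pred_eq_sub_one, Nat.add_sub_cancel, add_left_inj]
    split_ifs with h
    · rw [h.1]
    · simp

/-- The weight of an entry: the eigenvalue of `H`. -/
def wt (p : ℕ × ℕ × Γ) : ℤ := 2 * ((p.1 : ℤ) - p.2.1) - deg p.2.2

/-- The operator `H`. -/
def opH : Ker Γ →L[ℂ] Ker Γ := wcomp (fun p => (wt deg p : ℂ)) id

/-- The operator `K = q^{-H/2}`. -/
def opK : Ker Γ →L[ℂ] Ker Γ := wcomp (fun p => sq q ^ (-wt deg p)) id

/-- The operator `K⁻¹ = q^{H/2}`. -/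
def opKinv : Ker Γ →L[ℂ] Ker Γ := wcomp (fun p => sq q ^ (wt deg p)) id

/-- The operator `X⁺ F = -q^{1/2} (1 - q²)⁻¹ (z · K F - K⁻¹ F · z)`. -/
def opXp : Ker Γ →L[ℂ] Ker Γ :=
  (-(sq q / (1 - qc q ^ 2))) • (zL Γ * opK q deg - zR Γ * opKinv q deg)

/-- The operator `X⁻ F = q^{3/2} (1 - q²)⁻¹ (z* · K F - K⁻¹ F · z*)`. -/
def opXm : Ker Γ →L[ℂ] Ker Γ :=
  (sq q ^ 3 / (1 - qc q ^ 2)) • (zsL q Γ * opK q deg - zsR q Γ * opKinv q deg)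

/-- The action of the generators of `U_q su(1,1)` on kernels. -/
def actKer : UqGen → Ker Γ →L[ℂ] Ker Γ
  | .H => opH deg
  | .K => opK q deg
  | .Kinv => opKinv q deg
  | .Xp => opXp q deg
  | .Xm => opXm q deg

theorem wcomp_id_one {w : ℕ × ℕ × Γ → ℂ} {c : ℂ} (h : ∀ r, w (r, r, 0) = c) :
    wcomp w id (oneKer Γ) = c • oneKer Γ := by
  classical
  funext ⟨r, s, b⟩
  by_cases hrs : r = s ∧ b = 0
  · obtain ⟨rfl, rfl⟩ := hrs
    simp [oneKer, h]
  · simp [oneKer, hrs]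

theorem opH_one : opH deg (oneKer Γ) = 0 := by
  rw [opH, wcomp_id_one (c := 0) (by simp [wt]), zero_smul]

theorem opK_one : opK q deg (oneKer Γ) = oneKer Γ := by
  rw [opK, wcomp_id_one (c := 1) (by simp [wt]), one_smul]

theorem opKinv_one : opKinv q deg (oneKer Γ) = oneKer Γ := by
  rw [opKinv, wcomp_id_one (c := 1) (by simp [wt]), one_smul]

theorem opXp_one : opXp q deg (oneKer Γ) = 0 := by
  rw [opXp, smul_apply, sub_apply, mul_apply_eq_comp, mul_apply_eq_comp, opK_one, opKinv_one,
    zL_one, sub_self, smul_zero]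

theorem opXm_one : opXm q deg (oneKer Γ) = 0 := by
  rw [opXm, smul_apply, sub_apply, mul_apply_eq_comp, mul_apply_eq_comp, opK_one, opKinv_one,
    zsL_one, sub_self, smul_zero]

section Shift

variable {w : ℕ → ℂ} {σ : ℕ → ℕ} {β : Γ} {k : ℤ}
  (h : ∀ r, w r ≠ 0 → 2 * ((r : ℤ) - σ r) - deg β = k)

include h

/-- The hypothesis `h` says that the one-entry-per-row matrix is homogeneous of weight `k`. Rows
with `w r = 0` are exempt, since there `σ r` may be the meaningless `Nat.pred 0`. -/
theorem opH_lop : opH deg * lop w σ β = (k : ℂ) • lop w σ β + lop w σ β * opH deg := by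
  refine ContinuousLinearMap.ext fun F => funext fun ⟨r, s, b⟩ => ?_
  simp only [mul_apply_eq_comp, add_apply, smul_apply, Pi.add_apply, Pi.smul_apply, opH,
    wcomp_apply, lop_apply, wt, id, smul_eq_mul]
  by_cases hw : w r = 0
  · simp [hw]
  · rw [← h r hw, map_sub]
    push_cast
    ring

theorem opK_lop : opK q deg * lop w σ β = sq q ^ (-k) • (lop w σ β * opK q deg) := by
  refine ContinuousLinearMap.ext fun F => funext fun ⟨r, s, b⟩ => ?_
  simp only [mul_apply_eq_comp, smul_apply, Pi.smul_apply, opK,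
    wcomp_apply, lop_apply, wt, id, smul_eq_mul]
  by_cases hw : w r = 0
  · simp [hw]
  · have e : -(2 * ((r : ℤ) - s) - deg b)
        = -k + -(2 * ((σ r : ℤ) - s) - deg (b - β)) := by
      rw [← h r hw, map_sub]
      ring
    rw [e, zpow_add₀ (sq_ne_zero q)]
    ring

theorem opKinv_lop : opKinv q deg * lop w σ β = sq q ^ k • (lop w σ β * opKinv q deg) := by
  refine ContinuousLinearMap.ext fun F => funext fun ⟨r, s, b⟩ => ?_
  simp only [mul_apply_eq_comp, smul_apply, Pi.smul_apply, opKinv,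
    wcomp_apply, lop_apply, wt, id, smul_eq_mul]
  by_cases hw : w r = 0
  · simp [hw]
  · have e : 2 * ((r : ℤ) - s) - deg b
        = k + (2 * ((σ r : ℤ) - s) - deg (b - β)) := by
      rw [← h r hw, map_sub]
      ring
    rw [e, zpow_add₀ (sq_ne_zero q)]
    ring

/-- An operator of the form `F ↦ c (A · K F - K⁻¹ F · A)` is a twisted derivation. -/
theorem twisted_lop {Z Z' D : Ker Γ →L[ℂ] Ker Γ} {c : ℂ}
    (hZ : Z' * lop w σ β = lop w σ β * Z')
    (hD : c • (sq q ^ (-k) • (Z * lop w σ β) - sq q ^ k • (lop w σ β * Z)) = D) :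
    (c • (Z * opK q deg - Z' * opKinv q deg)) * lop w σ β
      = (sq q ^ k • lop w σ β) * (c • (Z * opK q deg - Z' * opKinv q deg)) + D * opK q deg := by
  rw [← hD]
  have h1 := opK_lop q deg h
  have h2 := opKinv_lop q deg h
  refine ContinuousLinearMap.ext fun F => ?_
  have h1 := DFunLike.congr_fun h1 F
  have h2 := DFunLike.congr_fun h2 F
  have hZ := DFunLike.congr_fun hZ (opKinv q deg F)
  simp only [mul_apply_eq_comp, add_apply, smul_apply, sub_apply, map_smul, map_sub] at h1 h2 hZ ⊢
  -- The shift passes through K and K⁻¹ with opposite powers of q^{1/2}, and commutes with the right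
  -- multiplication `Z'`. What fails to cancel is the twisted commutator of `Z` with the shift,
  -- which is `D`.
  rw [h1, h2, map_smul, map_smul, hZ]
  module

end Shift

end Action

/-! ### Covariance of realizations -/

namespace Realization

variable {A I Γ G : Type} [Ring A] [Algebra ℂ A] [AddCommGroup Γ] {c : A → I → ℂ}

/-- The triangular matrix with diagonal `K₀`, `K₁` and corner `X` intertwines the scalar matrices
`ρ.L a` with the entrywise image of `D a`. Both sides are multiplicative in `a`, so generators
suffice. The corner entry applied to the identity matrix gives the claim, as `K₁` fixes that matrix
and `X` kills it. -/
theorem act_of_generators (ρ : Realization c Γ) {t : G → A}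
    (ht : Algebra.adjoin ℂ (Set.range t) = ⊤) (D : A →ₐ[ℂ] Matrix (Fin 2) (Fin 2) A)
    {α δ β : G → A} (hD : ∀ g, D (t g) = tri (α g) (δ g) (β g))
    {K₀ K₁ X : Ker Γ →L[ℂ] Ker Γ}
    (h₀ : ∀ g, K₀ * ρ.L (t g) = ρ.L (α g) * K₀) (h₁ : ∀ g, K₁ * ρ.L (t g) = ρ.L (β g) * K₁)
    (h : ∀ g, X * ρ.L (t g) = ρ.L (α g) * X + ρ.L (δ g) * K₁)
    (hK : K₁ (oneKer Γ) = oneKer Γ) (hX : X (oneKer Γ) = 0) (a : A) :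
    ρ.L (D a 0 1) (oneKer Γ) = X (ρ.L a (oneKer Γ)) := by
  have key := intertwine_of_generators (A := A) (B := Matrix (Fin 2) (Fin 2) (Ker Γ →L[ℂ] Ker Γ))
    ht (ρ := (Matrix.scalarAlgHom (Fin 2) ℂ).comp ρ.L) (τ := ρ.L.mapMatrix.comp D) (P := tri K₀ X K₁)
    (fun g => by
      have e1 : (Matrix.scalarAlgHom (Fin 2) ℂ) (ρ.L (t g)) = tri (ρ.L (t g)) 0 (ρ.L (t g)) := by
        ext i j : 1
        fin_cases i <;> fin_cases j <;> simp [tri]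
      have e2 : ρ.L.mapMatrix (tri (α g) (δ g) (β g))
          = tri (ρ.L (α g)) (ρ.L (δ g)) (ρ.L (β g)) := by
        ext i j : 1
        fin_cases i <;> fin_cases j <;> simp [tri]
      rw [AlgHom.comp_apply, AlgHom.comp_apply, hD, e1, e2, tri_mul, tri_mul, h₀, h₁, mul_zero,
        zero_add, h]) a
  have h01 := congrFun (congrFun key 0) 1
  simp only [Matrix.mul_apply, Fin.sum_univ_two] at h01
  have h01 := DFunLike.congr_fun h01 (oneKer Γ)
  simp [tri, hK, hX] at h01
  exact h01.symm

theorem hom_of_generators (ρ : Realization c Γ) {t : G → A}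
    (ht : Algebra.adjoin ℂ (Set.range t) = ⊤) (D : A →ₐ[ℂ] A) {K : Ker Γ →L[ℂ] Ker Γ}
    (h : ∀ g, K * ρ.L (t g) = ρ.L (D (t g)) * K) (hK : K (oneKer Γ) = oneKer Γ) (a : A) :
    ρ.L (D a) (oneKer Γ) = K (ρ.L a (oneKer Γ)) := by
  have key := intertwine_of_generators ht (ρ := ρ.L) (τ := ρ.L.comp D) (P := K) h a
  have key := DFunLike.congr_fun key (oneKer Γ)
  rw [mul_apply_eq_comp, mul_apply_eq_comp, hK] at key
  exact key.symm

/-- A realization in which the generators act by shifts of definite weight intertwines the actions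
of `U_q su(1,1)`, as soon as `X^±` are given on generators by commutators with `z` and `z*`. -/
theorem act_of_shifts (ρ : Realization c Γ) {t : G → A}
    (ht : Algebra.adjoin ℂ (Set.range t) = ⊤) (q : Param) (deg : Γ →+ ℤ)
    {w : G → ℕ → ℂ} {σ : G → ℕ → ℕ} {β : G → Γ} {k : G → ℤ}
    (hL : ∀ g, ρ.L (t g) = lop (w g) (σ g) (β g))
    (hk : ∀ g r, w g r ≠ 0 → 2 * ((r : ℤ) - σ g r) - deg (β g) = k g)
    {κ ω : G → ℂ} (hκ : ∀ g, κ g = sq q ^ (-k g)) (hω : ∀ g, ω g = k g) {xp xm : G → A}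
    {H Xp Xm : A →ₐ[ℂ] Matrix (Fin 2) (Fin 2) A} {K Kinv : A →ₐ[ℂ] A}
    (hH : ∀ g, H (t g) = tri (t g) (ω g • t g) (t g)) (hK : ∀ g, K (t g) = κ g • t g)
    (hKinv : ∀ g, Kinv (t g) = (κ g)⁻¹ • t g)
    (hXp : ∀ g, Xp (t g) = tri ((κ g)⁻¹ • t g) (xp g) (κ g • t g))
    (hXm : ∀ g, Xm (t g) = tri ((κ g)⁻¹ • t g) (xm g) (κ g • t g))
    (hxp : ∀ g, (-(sq q / (1 - qc q ^ 2))) • (sq q ^ (-k g) • (zL Γ * lop (w g) (σ g) (β g))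
      - sq q ^ k g • (lop (w g) (σ g) (β g) * zL Γ)) = ρ.L (xp g))
    (hxm : ∀ g, (sq q ^ 3 / (1 - qc q ^ 2)) • (sq q ^ (-k g) • (zsL q Γ * lop (w g) (σ g) (β g))
      - sq q ^ k g • (lop (w g) (σ g) (β g) * zsL q Γ)) = ρ.L (xm g)) (ξ : UqGen) (a : A) :
    ρ.L (match ξ with
      | .H => H a 0 1
      | .K => K a
      | .Kinv => Kinv a
      | .Xp => Xp a 0 1
      | .Xm => Xm a 0 1) (oneKer Γ) = actKer q deg ξ (ρ.L a (oneKer Γ)) := by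
  have hκ' : ∀ g, (κ g)⁻¹ = sq q ^ k g := fun g => by rw [hκ, zpow_neg, inv_inv]
  have hopK : ∀ g, opK q deg * ρ.L (t g) = ρ.L (κ g • t g) * opK q deg := fun g => by
    rw [map_smul, hκ, hL, opK_lop q deg (hk g)]
    rfl
  have hopKinv : ∀ g, opKinv q deg * ρ.L (t g) = ρ.L ((κ g)⁻¹ • t g) * opKinv q deg :=
    fun g => by
      rw [map_smul, hκ', hL, opKinv_lop q deg (hk g)]
      rfl
  cases ξ with
  | H =>
    refine ρ.act_of_generators ht H hH (K₀ := 1) (K₁ := 1) (X := opH deg) (by simp) (by simp)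
      (fun g => ?_) (by simp) (opH_one _) a
    rw [map_smul, hω, hL, opH_lop deg (hk g), mul_one, add_comm]
  | K => exact ρ.hom_of_generators ht K (fun g => by rw [hK]; exact hopK g) (opK_one q _) a
  | Kinv =>
    exact ρ.hom_of_generators ht Kinv (fun g => by rw [hKinv]; exact hopKinv g) (opKinv_one q _) a
  | Xp =>
    refine ρ.act_of_generators ht Xp hXp hopKinv hopK (fun g => ?_) (opK_one q _) (opXp_one q _) a
    rw [map_smul, hκ', hL]
    exact twisted_lop q deg (hk g) (lop_rop_comm _ _ _ _ _ _).symm (hxp g)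
  | Xm =>
    refine ρ.act_of_generators ht Xm hXm hopKinv hopK (fun g => ?_) (opK_one q _) (opXm_one q _) a
    rw [map_smul, hκ', hL]
    exact twisted_lop q deg (hk g) (lop_rop_comm _ _ _ _ _ _).symm (hxm g)

end Realization

section Star

variable {Γ : Type} [AddCommGroup Γ] (q : Param)

/-- The squared norms `(1 - q²) ⋯ (1 - q^{2m})` of the basis vectors `e_m`. -/
def normSq (m : ℕ) : ℝ := ∏ i ∈ Finset.range m, (1 - (q : ℝ) ^ (2 * (i + 1)))

theorem normSq_ne_zero (m : ℕ) : (normSq q m : ℂ) ≠ 0 := by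
  have : normSq q m ≠ 0 := Finset.prod_ne_zero_iff.2 fun i _ =>
    (sub_pos.2 (pow_lt_one₀ q.2.1.le q.2.2 (by omega))).ne'
  exact_mod_cast this

theorem normSq_succ (m : ℕ) :
    (normSq q (m + 1) : ℂ) = normSq q m * (1 - qc q ^ (2 * (m + 1))) := by
  rw [normSq, Finset.prod_range_succ, ← normSq, qc]
  push_cast
  rfl

/-- The involution on kernels. -/
def starKer (F : Ker Γ) : Ker Γ := fun p =>
  (normSq q p.2.1 / normSq q p.1 : ℂ) * (starRingEnd ℂ) (F (p.2.1, p.1, -p.2.2))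

theorem starKer_apply (F : Ker Γ) (r s : ℕ) (b : Γ) : starKer q F (r, s, b)
    = (normSq q s / normSq q r : ℂ) * (starRingEnd ℂ) (F (s, r, -b)) := rfl

theorem continuous_starKer : Continuous (starKer q : Ker Γ → Ker Γ) := by
  refine continuous_pi fun p => continuous_const.mul ?_
  exact Complex.continuous_conj.comp (continuous_apply _)

theorem starKer_one : starKer q (oneKer Γ) = oneKer Γ := by
  classical
  funext ⟨r, s, b⟩
  by_cases h : r = s ∧ b = 0
  · obtain ⟨rfl, rfl⟩ := h
    simpa [starKer_apply, oneKer] using div_self (normSq_ne_zero q r)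
  · have h' : ¬(s = r ∧ b = 0) := fun ⟨h1, h2⟩ => h ⟨h1.symm, h2⟩
    simp [starKer_apply, oneKer, h, h']

theorem starKer_add (F F' : Ker Γ) : starKer q (F + F') = starKer q F + starKer q F' := by
  funext p
  simp [starKer, mul_add]

theorem starKer_smul (c : ℂ) (F : Ker Γ) :
    starKer q (c • F) = (starRingEnd ℂ) c • starKer q F := by
  funext p
  simp [starKer, mul_left_comm]

/-- Taking adjoints turns a left factor into a right factor of opposite degree. The hypothesis `h`
expresses that the two factors are adjoint for the norms `normSq`. -/
theorem starKer_lop {w w' : ℕ → ℂ} {σ : ℕ → ℕ} (β : Γ)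
    (h : ∀ s, normSq q s * (starRingEnd ℂ) (w s) = w' s * normSq q (σ s)) (F : Ker Γ) :
    starKer q (lop w σ β F) = rop w' σ (-β) (starKer q F) := by
  funext ⟨r, s, b⟩
  have e : -b - β = -(b + β) := by abel
  simp only [starKer_apply, lop_apply, rop_apply, map_mul, sub_neg_eq_add, e]
  rw [div_mul_eq_mul_div, ← mul_assoc, h]
  ring

/-- The induction needs the relation (aF)* = F* a* for every matrix F, which is stable under
products; the claim is the case F = 1. -/
theorem Realization.star_of_generators {A I G : Type} [Ring A] [Algebra ℂ A] {c : A → I → ℂ}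
    (ρ : Realization c Γ) {t : G → A} (ht : Algebra.adjoin ℂ (Set.range t) = ⊤)
    (S : A →ₐ[ℂ] ConjOp A)
    (h : ∀ g F, starKer q (ρ.L (t g) F) = (ρ.R (ofConj (S (t g)))).unop (starKer q F)) (a : A) :
    ρ.L (ofConj (S a)) (oneKer Γ) = starKer q (ρ.L a (oneKer Γ)) := by
  have key : ∀ F, starKer q (ρ.L a F) = (ρ.R (ofConj (S a))).unop (starKer q F) := by
    have ha : a ∈ Algebra.adjoin ℂ (Set.range t) := ht ▸ Algebra.mem_top
    induction ha using Algebra.adjoin_induction with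
    | mem x hx => obtain ⟨g, rfl⟩ := hx; exact h g
    | algebraMap r =>
      intro F
      have e : ofConj (S (algebraMap ℂ A r)) = algebraMap ℂ A ((starRingEnd ℂ) r) := by
        rw [AlgHom.commutes]
        rfl
      rw [e, AlgHom.commutes, AlgHom.commutes]
      exact starKer_smul q r F
    | add x y _ _ hx hy =>
      intro F
      have e : ofConj (S (x + y)) = ofConj (S x) + ofConj (S y) := by rw [map_add]; rfl
      rw [e, map_add, map_add, add_apply, starKer_add, hx, hy]
      rfl
    | mul x y _ _ hx hy =>
      intro F
      have e : ofConj (S (x * y)) = ofConj (S y) * ofConj (S x) := by rw [map_mul]; rfl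
      rw [e, map_mul, map_mul, mul_apply_eq_comp, hx, hy]
      rfl
  rw [← ρ.R_one, key, starKer_one]

end Star

/-! ### Algebras with generators -/

section Generators

variable {A G : Type} [Ring A] [Algebra ℂ A]

theorem adjoin_of_surjective {f : FreeAlgebra ℂ G →ₐ[ℂ] A} (hf : Function.Surjective f) :
    Algebra.adjoin ℂ (Set.range fun g => f (FreeAlgebra.ι ℂ g)) = ⊤ := by
  have h : (Set.range fun g => f (FreeAlgebra.ι ℂ g)) = f '' Set.range (FreeAlgebra.ι ℂ) := by
    rw [← Set.range_comp]
    rfl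
  rw [h, Algebra.adjoin_image, FreeAlgebra.adjoin_range_ι, Algebra.map_top]
  exact (AlgHom.range_eq_top f).2 hf

/-- A left ideal containing `1` is everything; it suffices to multiply by generators. -/
theorem submodule_eq_top_of_generators {t : G → A} (ht : Algebra.adjoin ℂ (Set.range t) = ⊤)
    (M : Submodule ℂ A) (h1 : 1 ∈ M) (h : ∀ g, ∀ x ∈ M, t g * x ∈ M) : M = ⊤ := by
  have key : ∀ a : A, ∀ x ∈ M, a * x ∈ M := by
    intro a
    have ha : a ∈ Algebra.adjoin ℂ (Set.range t) := ht ▸ Algebra.mem_top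
    induction ha using Algebra.adjoin_induction with
    | mem x hx => obtain ⟨g, rfl⟩ := hx; exact h g
    | algebraMap r => exact fun x hx => by rw [← Algebra.smul_def]; exact M.smul_mem _ hx
    | add x y _ _ hx hy => exact fun z hz => by rw [add_mul]; exact M.add_mem (hx z hz) (hy z hz)
    | mul x y _ _ hx hy => exact fun z hz => by rw [mul_assoc]; exact hx _ (hy z hz)
  exact (Submodule.eq_top_iff').2 fun a => by simpa using key a 1 h1

theorem semiconjBy_aeval {u a b : A} (h : SemiconjBy u a b) (p : ℂ[X]) :
    u * aeval a p = aeval b p * u := by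
  induction p using Polynomial.induction_on' with
  | add p p' h h' => rw [map_add, map_add, mul_add, add_mul, h, h']
  | monomial n c =>
    rw [aeval_monomial, aeval_monomial, ← mul_assoc, ← Algebra.commutes, mul_assoc,
      (h.pow_right n).eq, mul_assoc]

theorem aeval_smul_eq (k : ℂ) (v : A) (p : ℂ[X]) :
    aeval (k • v) p = aeval v (p.comp (C k * X)) := by
  rw [aeval_comp, map_mul, aeval_C, aeval_X, ← Algebra.smul_def]

/-- Moving `u` past each factor `v` costs a factor `k`, so the variable of `p` is rescaled. Normal
ordering rests on this rule and its mirror image `aeval_mul_comm`. -/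
theorem mul_aeval_comm {u v : A} {k : ℂ} (h : u * v = k • (v * u)) (p : ℂ[X]) :
    u * aeval v p = aeval v (p.comp (C k * X)) * u := by
  rw [← aeval_smul_eq]
  exact semiconjBy_aeval (by rw [SemiconjBy, h, smul_mul_assoc]) p

theorem aeval_mul_comm {u v : A} {k : ℂ} (h : v * u = k • (u * v)) (p : ℂ[X]) :
    aeval v p * u = u * aeval v (p.comp (C k * X)) := by
  rw [← aeval_smul_eq]
  exact (semiconjBy_aeval (by rw [SemiconjBy, h, mul_smul_comm]) p).symm

theorem mul_pow_comm_smul {u v : A} {k : ℂ} (h : v * u = k • (u * v)) (n : ℕ) :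
    v * u ^ n = k ^ n • (u ^ n * v) := by
  induction n with
  | zero => simp
  | succ n ih =>
    rw [pow_succ, ← mul_assoc, ih, smul_mul_assoc, mul_assoc, h, mul_smul_comm, smul_smul,
      mul_assoc, ← pow_succ]

theorem unop_pow_eq {B : Type} [Ring B] [Algebra ℂ B] (R : A →ₐ[ℂ] Bᵐᵒᵖ) (a : A) (n : ℕ) :
    (R (a ^ n)).unop = (R a).unop ^ n := by
  rw [map_pow, MulOpposite.unop_pow]

variable {Γ : Type} [AddCommGroup Γ] {t : G → A} (ht : Algebra.adjoin ℂ (Set.range t) = ⊤)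
  {L : A →ₐ[ℂ] (Ker Γ →L[ℂ] Ker Γ)} {R : A →ₐ[ℂ] (Ker Γ →L[ℂ] Ker Γ)ᵐᵒᵖ}

include ht

theorem left_comm_of_generators (hL : ∀ g, ∃ w σ β, L (t g) = lop w σ β) (a : A) (w : ℕ → ℂ)
    (σ : ℕ → ℕ) (β : Γ) : rop w σ β * L a = L a * rop w σ β := by
  refine intertwine_of_generators ht (fun g => ?_) a
  obtain ⟨w', σ', β', h⟩ := hL g
  rw [h, lop_rop_comm]

theorem right_comm_of_generators (hR : ∀ g, ∃ w σ β, (R (t g)).unop = rop w σ β) (a : A)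
    (w : ℕ → ℂ) (σ : ℕ → ℕ) (β : Γ) : lop w σ β * (R a).unop = (R a).unop * lop w σ β := by
  have h := intertwine_of_generators ht (ρ := R) (τ := R) (P := MulOpposite.op (lop w σ β))
    (fun g => by
      obtain ⟨w', σ', β', h⟩ := hR g
      apply MulOpposite.unop_injective
      rw [MulOpposite.unop_mul, MulOpposite.unop_mul, h, MulOpposite.unop_op, lop_rop_comm]) a
  have h := congrArg MulOpposite.unop h
  rw [MulOpposite.unop_mul, MulOpposite.unop_mul, MulOpposite.unop_op] at h
  exact h.symm

/-- Left and right multiplications commute, whence (xy) · 1 = x · (y · 1) = x · (1 · y) = (x · 1) ·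
y = (1 · x) · y. -/
theorem right_one_of_generators (hL : ∀ g, ∃ w σ β, L (t g) = lop w σ β)
    (hR : ∀ g, ∃ w σ β, (R (t g)).unop = rop w σ β)
    (h1 : ∀ g, (R (t g)).unop (oneKer Γ) = L (t g) (oneKer Γ)) (a : A) :
    (R a).unop (oneKer Γ) = L a (oneKer Γ) := by
  have hc : ∀ a b, (R b).unop * L a = L a * (R b).unop := fun a b =>
    intertwine_of_generators ht (fun g => by
      obtain ⟨w, σ, β, h⟩ := hL g
      rw [h, right_comm_of_generators ht hR]) a
  have ha : a ∈ Algebra.adjoin ℂ (Set.range t) := ht ▸ Algebra.mem_top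
  induction ha using Algebra.adjoin_induction with
  | mem x hx => obtain ⟨g, rfl⟩ := hx; exact h1 g
  | algebraMap r => rw [AlgHom.commutes, AlgHom.commutes]; rfl
  | add x y _ _ hx hy => rw [map_add, map_add, MulOpposite.unop_add, add_apply, add_apply, hx, hy]
  | mul x y _ _ hx hy =>
    rw [map_mul, map_mul, MulOpposite.unop_mul, mul_apply_eq_comp, mul_apply_eq_comp, hx, ← hy,
      ← mul_apply_eq_comp, hc, mul_apply_eq_comp]

end Generators

/-! ### The realization of the quantum disc -/

section Disc

variable (q : Param)

theorem adjoin_gU : Algebra.adjoin ℂ (Set.range (gU q)) = ⊤ :=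
  adjoin_of_surjective (RingQuot.mkAlgHom_surjective ℂ (RelU q))

@[simp] theorem liftU_gU {B : Type} [Ring B] [Algebra ℂ B] (g : GenU → B)
    (h : g .zs * g .z = qc q ^ 2 • (g .z * g .zs) + (1 - qc q ^ 2) • 1) (x : GenU) :
    liftU q g h (gU q x) = g x := by
  change liftU q g h (RingQuot.mkAlgHom ℂ (RelU q) (FreeAlgebra.ι ℂ x)) = g x
  exact (RingQuot.liftAlgHom_mkAlgHom_apply _ _ _ _).trans (FreeAlgebra.lift_ι_apply _ _)

/-- The row weights of the generators of `Pol(ℂ)_q`. -/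
def rowWtU : GenU → ℕ → ℂ
  | .z => shiftWt
  | .zs => fun r => 1 - qc q ^ (2 * (r + 1))

/-- The row shifts of the generators of `Pol(ℂ)_q`. -/
def rowShiftU : GenU → ℕ → ℕ
  | .z => Nat.pred
  | .zs => Nat.succ

/-- The column weights of the generators of `Pol(ℂ)_q`. -/
def colWtU : GenU → ℕ → ℂ
  | .z => fun _ => 1
  | .zs => fun s => 1 - qc q ^ (2 * s)

/-- The column shifts of the generators of `Pol(ℂ)_q`. -/
def colShiftU : GenU → ℕ → ℕ
  | .z => Nat.succ
  | .zs => Nat.pred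

/-- Left multiplication of kernels by elements of `Pol(ℂ)_q`. -/
def leftU : PolU q →ₐ[ℂ] (Ker Unit →L[ℂ] Ker Unit) :=
  liftU q (fun g => lop (rowWtU q g) (rowShiftU g) 0) (by
    refine ContinuousLinearMap.ext fun F => funext fun ⟨r, s, b⟩ => ?_
    -- Row 0 is separate: there `Nat.pred` returns 0 and only the weight `shiftWt 0 = 0` makes the
    -- entry correct.
    rcases r with _ | r <;> simp [rowWtU, rowShiftU, lop_apply] <;> ring)

/-- Right multiplication of kernels by elements of `Pol(ℂ)_q`. -/
def rightU : PolU q →ₐ[ℂ] (Ker Unit →L[ℂ] Ker Unit)ᵐᵒᵖ :=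
  liftU q (fun g => MulOpposite.op (rop (colWtU q g) (colShiftU g) 0)) (by
    apply MulOpposite.unop_injective
    refine ContinuousLinearMap.ext fun F => funext fun ⟨r, s, b⟩ => ?_
    rcases s with _ | s <;> simp [colWtU, colShiftU, rop_apply] <;> ring)

theorem leftU_gU (g : GenU) : leftU q (gU q g) = lop (rowWtU q g) (rowShiftU g) 0 :=
  liftU_gU q _ _ g

theorem rightU_gU (g : GenU) : (rightU q (gU q g)).unop = rop (colWtU q g) (colShiftU g) 0 := by
  rw [rightU, liftU_gU]
  rfl

theorem rightU_one (a : PolU q) :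
    (rightU q a).unop (oneKer Unit) = leftU q a (oneKer Unit) := by
  refine right_one_of_generators (adjoin_gU q) (fun g => ⟨_, _, _, leftU_gU q g⟩) (fun g => ⟨_, _, _, rightU_gU q g⟩) (fun g => ?_) a
  rw [leftU_gU, rightU_gU]
  cases g
  · exact zL_one.symm
  · exact (zsL_one q).symm

theorem leftU_yU : leftU q (yU q) = lop (fun r => qc q ^ (2 * r)) id 0 := by
  rw [yU, map_sub, map_mul, map_one, leftU_gU, leftU_gU]
  refine ContinuousLinearMap.ext fun F => funext fun ⟨r, s, b⟩ => ?_
  rcases r with _ | r <;> simp [rowWtU, rowShiftU, lop_apply]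
  ring

/-! ### Normal-form coefficients in the disc as matrix entries -/

/-- The position `(m + j⁺, m + j⁻)` of the coordinate `(j, m)`. -/
def posU : ℤ × ℕ ≃ ℕ × ℕ × Unit where
  toFun k := (k.2 + k.1.toNat, k.2 + (-k.1).toNat, ())
  invFun p := ((p.1 : ℤ) - p.2.1, min p.1 p.2.1)
  left_inv k := by
    obtain ⟨j, m⟩ := k
    simp only [Prod.mk.injEq]
    omega
  right_inv p := by
    obtain ⟨r, s, b⟩ := p
    simp only [Prod.mk.injEq, and_true]
    omega

theorem posU_apply (j : ℤ) (m : ℕ) : posU (j, m) = (m + j.toNat, m + (-j).toNat, ()) := rfl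

/-- The factor between the coordinate `(j, m)` and the corresponding matrix entry. -/
def weightU (k : ℤ × ℕ) : ℂ :=
  (∏ i ∈ Finset.range k.1.toNat, shiftWt (k.2 + k.1.toNat - i)) *
    ∏ i ∈ Finset.range (-k.1).toNat, (1 - qc q ^ (2 * (k.2 + (-k.1).toNat - i)))

theorem shiftWt_eq_zero (r : ℕ) : shiftWt r = 0 ↔ r = 0 := by simp [shiftWt]

theorem one_sub_pow_eq_zero (r : ℕ) : 1 - qc q ^ (2 * r) = 0 ↔ r = 0 := by
  constructor
  · intro h
    by_contra hr
    exact qc_pow_ne_one q (n := 2 * r) (by omega) h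
  · rintro rfl
    simp

theorem weightU_ne_zero (k : ℤ × ℕ) : weightU q k ≠ 0 :=
  mul_ne_zero ((prod_shift_ne_zero_iff shiftWt_eq_zero _ _).2 (by omega))
    ((prod_shift_ne_zero_iff (one_sub_pow_eq_zero q) _ _).2 (by omega))

/-- The linear map `ψ ↦ ∑ z^j ψ_j(y) + ⋯`. -/
def sumULin : (ℤ →₀ ℂ[X]) →ₗ[ℂ] PolU q :=
  Finsupp.lsum ℂ fun j => LinearMap.mulRight ℂ (gU q .zs ^ (-j).toNat) ∘ₗ
    LinearMap.mulLeft ℂ (gU q .z ^ j.toNat) ∘ₗ (aeval (yU q)).toLinearMap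

theorem sumULin_apply (ψ : ℤ →₀ ℂ[X]) : sumULin q ψ = sumU q ψ := rfl

theorem sumU_single (j : ℤ) (p : ℂ[X]) : sumU q (Finsupp.single j p)
    = gU q .z ^ j.toNat * aeval (yU q) p * gU q .zs ^ (-j).toNat := by
  rw [sumU, Finsupp.sum_single_index (by simp)]

/-- In normal order the powers of z act on rows and those of z* can be made to act on columns of the
identity matrix. The result lives on the diagonal r - s = j', where the polynomial in y contributes
its value at the eigenvalue q^{2m}. -/
theorem leftU_monomial (j j' : ℤ) (m : ℕ) (p : ℂ[X]) :
    leftU q (gU q .z ^ j'.toNat * aeval (yU q) p * gU q .zs ^ (-j').toNat) (oneKer Unit)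
      (posU (j, m)) = if j' = j then weightU q (j, m) * p.eval (qc q ^ (2 * m)) else 0 := by
  rw [map_mul, mul_apply_eq_comp, ← rightU_one, unop_pow_eq, rightU_gU, map_mul, map_pow, leftU_gU,
    ← aeval_algHom_apply, leftU_yU, aeval_lop_diag, mul_apply_eq_comp, posU_apply]
  simp only [rowWtU, rowShiftU, colWtU, colShiftU, lop_pred_pow, lop_apply, rop_pred_pow]
  split_ifs with h
  · subst h
    simp [weightU, oneKer]
    ring
  -- Off that diagonal the identity matrix contributes 0, unless an exponent exceeds the row or
  -- column index; in that case a weight vanishes.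
  · by_cases h1 : j'.toNat ≤ m + j.toNat
    · by_cases h2 : (-j').toNat ≤ m + (-j).toNat
      · have : ¬ (m + j.toNat - j'.toNat = m + (-j).toNat - (-j').toNat) := by omega
        simp [oneKer, this]
      · rw [not_not.1 (mt (prod_shift_ne_zero_iff (one_sub_pow_eq_zero q) _ _).1 h2)]
        simp
    · rw [not_not.1 (mt (prod_shift_ne_zero_iff shiftWt_eq_zero _ _).1 h1)]
      simp

theorem leftU_sumU (ψ : ℤ →₀ ℂ[X]) (k : ℤ × ℕ) :
    leftU q (sumU q ψ) (oneKer Unit) (posU k)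
      = weightU q k * (ψ k.1).eval (qc q ^ (2 * k.2)) := by
  obtain ⟨j, m⟩ := k
  rw [sumU, Finsupp.sum, map_sum, sum_apply, Finset.sum_apply]
  simp only [leftU_monomial]
  rw [Finset.sum_ite_eq']
  split_ifs with h
  · rfl
  · rw [Finsupp.notMem_support_iff.1 h, eval_zero, mul_zero]

theorem qc_pow_injective : Function.Injective fun m : ℕ => qc q ^ (2 * m) := by
  intro m n h
  have h' : (q : ℝ) ^ (2 * m) = (q : ℝ) ^ (2 * n) := by
    have h : qc q ^ (2 * m) = qc q ^ (2 * n) := h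
    rw [qc] at h
    exact_mod_cast h
  have := (pow_right_strictAnti₀ q.2.1 q.2.2).injective h'
  omega

theorem eq_of_eval_eq {x : ℕ → ℂ} (hx : Function.Injective x) {p p' : ℂ[X]}
    (h : ∀ m, p.eval (x m) = p'.eval (x m)) : p = p' :=
  Polynomial.eq_of_infinite_eval_eq p p'
    ((Set.infinite_range_of_injective hx).mono (by rintro _ ⟨m, rfl⟩; exact h m))

/-- The matrix entries determine the values of each coefficient at the infinitely many distinct
points q^{2m}. -/
theorem sumU_injective : Function.Injective (sumU q) := by
  intro ψ ψ' h
  refine Finsupp.ext fun j => eq_of_eval_eq (qc_pow_injective q) fun m => ?_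
  have h1 := leftU_sumU q ψ (j, m)
  rw [h, leftU_sumU] at h1
  exact (mul_left_cancel₀ (weightU_ne_zero q _) h1).symm

/-! ### Spanning by normally ordered monomials in the disc -/

theorem z_zs : gU q .z * gU q .zs = 1 - yU q := by rw [yU]; abel

theorem zs_z : gU q .zs * gU q .z = 1 - qc q ^ 2 • yU q := by
  rw [gU_r, yU]
  module

theorem yU_z : yU q * gU q .z = qc q ^ 2 • (gU q .z * yU q) := by
  have h : yU q * gU q .z = gU q .z - gU q .z * (gU q .zs * gU q .z) := by
    rw [yU, sub_mul, one_mul, mul_assoc]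
  rw [h, zs_z, mul_sub, mul_one, sub_sub_cancel, mul_smul_comm]

theorem zs_yU : gU q .zs * yU q = qc q ^ 2 • (yU q * gU q .zs) := by
  have h : gU q .zs * yU q = gU q .zs - (gU q .zs * gU q .z) * gU q .zs := by
    rw [yU, mul_sub, mul_one, mul_assoc]
  rw [h, zs_z, sub_mul, one_mul, sub_sub_cancel, smul_mul_assoc]

/-- The innermost pair is eliminated by z p(y) z* = p(q⁻² y)(1 - y), which lowers both exponents
until one of them is 0. -/
theorem monomial_mem_range (a b : ℕ) (p : ℂ[X]) :
    gU q .z ^ a * aeval (yU q) p * gU q .zs ^ b ∈ LinearMap.range (sumULin q) := by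
  induction a generalizing b p with
  | zero => exact ⟨Finsupp.single (-b : ℤ) p, by rw [sumULin_apply, sumU_single]; simp⟩
  | succ a ih =>
    rcases b with _ | b
    · refine ⟨Finsupp.single ((a + 1 : ℕ) : ℤ) p, ?_⟩
      rw [sumULin_apply, sumU_single, Int.toNat_natCast,
        Int.toNat_of_nonpos (by omega : -((a + 1 : ℕ) : ℤ) ≤ 0)]
    · have hz : gU q .z * yU q = (qc q ^ 2)⁻¹ • (yU q * gU q .z) := by
        rw [yU_z, inv_smul_smul₀ (pow_ne_zero _ (qc_ne_zero q))]
      have h : gU q .z ^ (a + 1) * aeval (yU q) p * gU q .zs ^ (b + 1)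
          = gU q .z ^ a * aeval (yU q) (p.comp (C (qc q ^ 2)⁻¹ * X) * (1 - X)) * gU q .zs ^ b := by
        rw [map_mul, map_sub, map_one, aeval_X, ← z_zs, pow_succ, pow_succ', mul_assoc (_ ^ a),
          mul_aeval_comm hz]
        simp only [mul_assoc]
      rw [h]
      exact ih _ _

/-- The range contains 1, so it is enough that it be stable under left multiplication by z and z*.
The one case needing work is z* in front of a positive power of z: z* z = 1 - q² y is then moved to
the right through the remaining powers. -/
theorem sumU_surjective : Function.Surjective (sumU q) := by
  have h : LinearMap.range (sumULin q) = ⊤ := by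
    refine submodule_eq_top_of_generators (adjoin_gU q) _ ?_ ?_
    · simpa using monomial_mem_range q 0 0 1
    · rintro g _ ⟨ψ, rfl⟩
      induction ψ using Finsupp.induction_linear with
      | zero => simp
      | add ψ ψ' h h' => rw [map_add, mul_add]; exact Submodule.add_mem _ h h'
      | single j p =>
        rw [sumULin_apply, sumU_single]
        generalize j.toNat = a
        generalize (-j).toNat = b
        cases g with
        | z =>
          rw [← mul_assoc, ← mul_assoc, ← pow_succ']
          exact monomial_mem_range q _ _ _
        | zs =>
          rcases a with _ | a
          · rw [pow_zero, one_mul, ← mul_assoc, mul_aeval_comm (zs_yU q), mul_assoc, ← pow_succ']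
            simpa only [pow_zero, one_mul] using
              monomial_mem_range q 0 (b + 1) (p.comp (C (qc q ^ 2) * X))
          · have h1 : 1 - qc q ^ 2 • yU q = aeval (yU q) (1 - C (qc q ^ 2) * X) := by
              simp [Algebra.smul_def]
            rw [pow_succ', ← mul_assoc, ← mul_assoc, ← mul_assoc, zs_z, h1,
              aeval_mul_comm (mul_pow_comm_smul (yU_z q) a), mul_assoc (_ ^ a), ← map_mul]
            exact monomial_mem_range q _ _ _
  exact fun f => LinearMap.range_eq_top.1 h f

theorem coordU_sumU (ψ : ℤ →₀ ℂ[X]) (k : ℤ × ℕ) :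
    coordU q (sumU q ψ) k = (ψ k.1).eval (qc q ^ (2 * k.2)) := by
  rw [coordU, Function.leftInverse_invFun (sumU_injective q)]

theorem denseRange_coordU : DenseRange (coordU q) := by
  have h := denseRange_evalFamily (ι := ℤ) (qc_pow_injective q)
  refine Dense.mono ?_ h
  rintro _ ⟨ψ, rfl⟩
  exact ⟨sumU q ψ, funext fun k => coordU_sumU q ψ k⟩

/-- The realization of the quantum disc by matrices. -/
def realU : Realization (coordU q) Unit where
  toKer := rescale posU (weightU q) (weightU_ne_zero q)
  L := leftU q
  R := rightU q
  L_comm := left_comm_of_generators (adjoin_gU q) (fun g => ⟨_, _, _, leftU_gU q g⟩)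
  R_comm := right_comm_of_generators (adjoin_gU q) (fun g => ⟨_, _, _, rightU_gU q g⟩)
  R_one := rightU_one q
  toKer_coord a := by
    obtain ⟨ψ, rfl⟩ := sumU_surjective q a
    funext p
    obtain ⟨k, rfl⟩ := posU.surjective p
    rw [rescale_apply, coordU_sumU, leftU_sumU]
  dense := denseRange_coordU q

/-! ### Action and involution in the disc -/

/-- The degree of the trivial grading. -/
abbrev degU : Unit →+ ℤ := 0

/-- The weights of the generators of `Pol(ℂ)_q`. -/
def genWtU : GenU → ℤ
  | .z => 2
  | .zs => -2

theorem actDistU_eq (ξ : UqGen) (F : DistU) :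
    actDistU q ξ F = (realU q).toKer.symm (actKer q degU ξ ((realU q).toKer F)) := by
  have hs := sq_ne_zero q
  -- This is the denominator 1 - q² of X^±, rewritten through q^{1/2} for `field_simp`.
  have hq : 1 - sq q ^ 4 ≠ 0 := by
    have h := qc_pow_ne_one q two_ne_zero
    rwa [qc_eq, ← pow_mul] at h
  refine (realU q).contExt_eq (S := actKer q degU ξ) (actKer q degU ξ).continuous (fun a => ?_) F
  have key := (realU q).act_of_shifts (adjoin_gU q) q degU (k := genWtU) (leftU_gU q)
    (H := HHomU q) (K := KHomU q) (Kinv := KinvHomU q) (Xp := XpHomU q) (Xm := XmHomU q)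
    ?_ ?_ ?_ (fun g => liftU_gU q _ _ g) (fun g => liftU_gU q _ _ g) (fun g => liftU_gU q _ _ g)
    (fun g => liftU_gU q _ _ g) (fun g => liftU_gU q _ _ g) ?_ ?_ ξ a
  · rw [← key]
    cases ξ <;> rfl
  · intro g r hr
    cases g with
    | z =>
      rcases r with _ | r
      · exact absurd rfl hr
      · simp [rowShiftU, genWtU]
    | zs => simp [rowShiftU, genWtU]
  · intro g
    cases g <;> simp [kU, genWtU, qc_eq]
  · intro g
    cases g <;> simp [wtU, genWtU]
  · intro g
    change _ = leftU q (xpU q g)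
    refine ContinuousLinearMap.ext fun F => funext fun ⟨r, s, b⟩ => ?_
    -- The commutators involve up to two predecessor steps, so rows 0 and 1 are checked apart from
    -- the generic row.
    cases g <;> rcases r with _ | _ | r <;>
    simp [xpU, leftU_gU, rowWtU, rowShiftU, genWtU, lop_apply, zL, qc_eq] <;>
    field_simp <;> ring
  · intro g
    change _ = leftU q (xmU q g)
    refine ContinuousLinearMap.ext fun F => funext fun ⟨r, s, b⟩ => ?_
    cases g <;> rcases r with _ | _ | r <;>
    simp [xmU, leftU_gU, rowWtU, rowShiftU, genWtU, lop_apply, zsL, qc_eq] <;>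
    field_simp <;> ring

/-- The adjointness of z and z* is the recursion `normSq_succ` for the norms. -/
theorem starDistU_eq (F : DistU) :
    starDistU q F = (realU q).toKer.symm (starKer q ((realU q).toKer F)) := by
  refine (realU q).contExt_eq (continuous_starKer q) (fun a => ?_) F
  refine (realU q).star_of_generators q (adjoin_gU q) (starHomU q) (fun g F => ?_) a
  change starKer q (leftU q _ F) = (rightU q _).unop _
  rw [starHomU, liftU_gU, leftU_gU]
  cases g with
  | z =>
    change _ = (rightU q (gU q .zs)).unop _
    rw [rightU_gU, starKer_lop (w' := colWtU q .zs), neg_zero]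
    · rfl
    · intro s
      rcases s with _ | s
      · simp [rowWtU, colWtU]
      · simp [rowWtU, colWtU, rowShiftU, normSq_succ, mul_comm]
  | zs =>
    change _ = (rightU q (gU q .z)).unop _
    rw [rightU_gU, starKer_lop (w' := colWtU q .z), neg_zero]
    · rfl
    · intro s
      simp [rowWtU, colWtU, rowShiftU, normSq_succ, conj_qc]

end Disc

/-! ### The realization of the quantum principal homogeneous space -/

section Homogeneous

variable (q : Param)

theorem adjoin_tX : Algebra.adjoin ℂ (Set.range (tX q)) = ⊤ :=
  adjoin_of_surjective (RingQuot.mkAlgHom_surjective ℂ (RelX q))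

@[simp] theorem liftX_tX {B : Type} [Ring B] [Algebra ℂ B] (g : GenX → B) (h : RelsX q g)
    (x : GenX) : liftX q g h (tX q x) = g x := by
  change liftX q g h (RingQuot.mkAlgHom ℂ (RelX q) (FreeAlgebra.ι ℂ x)) = g x
  exact (RingQuot.liftAlgHom_mkAlgHom_apply _ _ _ _).trans (FreeAlgebra.lift_ι_apply _ _)

/-- The row weights of the generators of `Pol(X̃)_q`. -/
def rowWtX : GenX → ℕ → ℂ
  | .t11 => fun r => shiftWt r * (qc q)⁻¹ ^ r
  | .t12 => fun r => (qc q)⁻¹ ^ r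
  | .t21 => fun r => -(qc q)⁻¹ ^ (r + 1)
  | .t22 => fun r => -((qc q)⁻¹ ^ (r + 1) * (1 - qc q ^ (2 * (r + 1))))

/-- The row shifts of the generators of `Pol(X̃)_q`. -/
def rowShiftX : GenX → ℕ → ℕ
  | .t11 => Nat.pred
  | .t12 => id
  | .t21 => id
  | .t22 => Nat.succ

/-- The column weights of the generators of `Pol(X̃)_q`. -/
def colWtX : GenX → ℕ → ℂ
  | .t11 => fun s => (qc q)⁻¹ ^ (s + 1)
  | .t12 => fun s => (qc q)⁻¹ ^ s
  | .t21 => fun s => -(qc q)⁻¹ ^ (s + 1)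
  | .t22 => fun s => -((qc q)⁻¹ ^ s * (1 - qc q ^ (2 * s)))

/-- The column shifts of the generators of `Pol(X̃)_q`. -/
def colShiftX : GenX → ℕ → ℕ
  | .t11 => Nat.succ
  | .t12 => id
  | .t21 => id
  | .t22 => Nat.pred

/-- The degrees of the generators of `Pol(X̃)_q` with respect to the rotations `i_φ`. -/
def rotDeg : GenX → ℤ
  | .t11 => 1
  | .t12 => 1
  | .t21 => -1
  | .t22 => -1

/-- Left multiplication of kernels by elements of `Pol(X̃)_q`. -/
def leftX : PolX q →ₐ[ℂ] (Ker ℤ →L[ℂ] Ker ℤ) :=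
  liftX q (fun g => lop (rowWtX q g) (rowShiftX g) (rotDeg g)) (by
    have hq := qc_ne_zero q
    constructor <;>
    refine ContinuousLinearMap.ext fun F => funext fun ⟨r, s, b⟩ => ?_ <;>
    rcases r with _ | r <;>
    simp [rowWtX, rowShiftX, rotDeg, lop_apply] <;> field_simp <;> ring)

/-- Right multiplication of kernels by elements of `Pol(X̃)_q`. -/
def rightX : PolX q →ₐ[ℂ] (Ker ℤ →L[ℂ] Ker ℤ)ᵐᵒᵖ :=
  liftX q (fun g => MulOpposite.op (rop (colWtX q g) (colShiftX g) (rotDeg g))) (by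
    have hq := qc_ne_zero q
    constructor <;>
    apply MulOpposite.unop_injective <;>
    refine ContinuousLinearMap.ext fun F => funext fun ⟨r, s, b⟩ => ?_ <;>
    rcases s with _ | s <;>
    simp [colWtX, colShiftX, rotDeg, rop_apply] <;> field_simp <;> ring)

theorem leftX_tX (g : GenX) :
    leftX q (tX q g) = lop (rowWtX q g) (rowShiftX g) (rotDeg g) := liftX_tX q _ _ g

theorem rightX_tX (g : GenX) :
    (rightX q (tX q g)).unop = rop (colWtX q g) (colShiftX g) (rotDeg g) := by
  rw [rightX, liftX_tX]
  rfl

theorem rightX_one (a : PolX q) :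
    (rightX q a).unop (oneKer ℤ) = leftX q a (oneKer ℤ) := by
  classical
  refine right_one_of_generators (adjoin_tX q) (fun g => ⟨_, _, _, leftX_tX q g⟩)
    (fun g => ⟨_, _, _, rightX_tX q g⟩) (fun g => ?_) a
  rw [leftX_tX, rightX_tX]
  funext ⟨r, s, b⟩
  simp only [lop_apply, rop_apply, oneKer]
  cases g <;> rcases r with _ | r <;> rcases s with _ | s <;>
  simp [rowWtX, colWtX, rowShiftX, colShiftX, rotDeg] <;>
  split_ifs with h <;> simp_all

/-! ### Adjoints of the generators as weighted shifts -/

theorem starX_tX (g : GenX) : starX q (tX q g) = starGenX q g := by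
  rw [starX, starHomX, liftX_tX]
  rfl

/-- The adjoint `t₁₂* = -q t₂₁`. -/
theorem starX_t12 : starX q (tX q .t12) = -(qc q • tX q .t21) := starX_tX q _

/-- The adjoint `t₁₁* = -t₂₂`. -/
theorem starX_t11 : starX q (tX q .t11) = -tX q .t22 := starX_tX q _

theorem leftX_star_t12 :
    leftX q (starX q (tX q .t12)) = lop (fun r => (qc q)⁻¹ ^ r) id (-1) := by
  have hq := qc_ne_zero q
  rw [starX_t12, map_neg, map_smul, leftX_tX]
  refine ContinuousLinearMap.ext fun F => funext fun ⟨r, s, b⟩ => ?_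
  simp [rowWtX, rowShiftX, rotDeg, lop_apply, pow_succ]
  field_simp

theorem rightX_star_t12 :
    (rightX q (starX q (tX q .t12))).unop = rop (fun s => (qc q)⁻¹ ^ s) id (-1) := by
  have hq := qc_ne_zero q
  rw [starX_t12, map_neg, map_smul, MulOpposite.unop_neg, MulOpposite.unop_smul, rightX_tX]
  refine ContinuousLinearMap.ext fun F => funext fun ⟨r, s, b⟩ => ?_
  simp [colWtX, colShiftX, rotDeg, rop_apply, pow_succ]
  field_simp

theorem rightX_star_t11 : (rightX q (starX q (tX q .t11))).unop
    = rop (fun s => (qc q)⁻¹ ^ s * (1 - qc q ^ (2 * s))) Nat.pred (-1) := by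
  rw [starX_t11, map_neg, MulOpposite.unop_neg, rightX_tX]
  refine ContinuousLinearMap.ext fun F => funext fun ⟨r, s, b⟩ => ?_
  simp [colWtX, colShiftX, rotDeg, rop_apply]

theorem leftX_xX : leftX q (xX q) = lop (fun r => (qc q)⁻¹ ^ (2 * r)) id 0 := by
  rw [xX, map_mul, leftX_tX, leftX_star_t12]
  refine ContinuousLinearMap.ext fun F => funext fun ⟨r, s, b⟩ => ?_
  simp [rowWtX, rowShiftX, rotDeg, lop_apply]
  ring

/-! ### Normal-form coefficients on X̃ as graded matrix entries -/

/-- The position `(m + i₁, m + j₁)` of the coordinate `(μ, m)`, in degree `i₁ + i₂ - j₁ - j₂`. -/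
def posX : MIdx × ℕ ≃ ℕ × ℕ × ℤ where
  toFun k := (k.2 + k.1.i₁, k.2 + k.1.j₁, (k.1.i₁ + k.1.i₂ - k.1.j₁ - k.1.j₂ : ℤ))
  -- The difference of row and column is i₁ - j₁, and what remains of the degree is i₂ - j₂. Since
  -- i₁ j₁ = i₂ j₂ = 0, the exponents are the positive and negative parts of these integers.
  invFun p := (⟨p.1 - p.2.1, (p.2.2 - p.1 + p.2.1).toNat, p.2.1 - p.1,
    (-(p.2.2 - p.1 + p.2.1)).toNat,
    by rw [mul_eq_zero]; omega, by rw [mul_eq_zero]; omega⟩, min p.1 p.2.1)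
  left_inv k := by
    obtain ⟨⟨i₁, i₂, j₁, j₂, h₁, h₂⟩, m⟩ := k
    rw [mul_eq_zero] at h₁ h₂
    simp only [Prod.mk.injEq, MIdx.mk.injEq]
    omega
  right_inv p := by
    obtain ⟨r, s, b⟩ := p
    simp only [Prod.mk.injEq]
    omega

theorem posX_apply (μ : MIdx) (m : ℕ) :
    posX (μ, m) = (m + μ.i₁, m + μ.j₁, (μ.i₁ + μ.i₂ - μ.j₁ - μ.j₂ : ℤ)) := rfl

/-- The factor between the coordinate `(μ, m)` and the corresponding matrix entry. -/
def weightX (k : MIdx × ℕ) : ℂ :=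
  (∏ i ∈ Finset.range k.1.i₁, rowWtX q .t11 (k.2 + k.1.i₁ - i)) *
    (((qc q)⁻¹ ^ k.2) ^ k.1.i₂ * ((qc q)⁻¹ ^ k.2) ^ k.1.j₂) *
    ∏ i ∈ Finset.range k.1.j₁,
      ((qc q)⁻¹ ^ (k.2 + k.1.j₁ - i) * (1 - qc q ^ (2 * (k.2 + k.1.j₁ - i))))

theorem rowWtX_t11_eq_zero (r : ℕ) : rowWtX q .t11 r = 0 ↔ r = 0 := by
  simp [rowWtX, shiftWt_eq_zero, qc_ne_zero]

theorem colWt_star_t11_eq_zero (s : ℕ) :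
    (qc q)⁻¹ ^ s * (1 - qc q ^ (2 * s)) = 0 ↔ s = 0 := by
  rw [mul_eq_zero, one_sub_pow_eq_zero]
  simp [qc_ne_zero]

theorem weightX_ne_zero (k : MIdx × ℕ) : weightX q k ≠ 0 := by
  have h : (qc q)⁻¹ ≠ 0 := inv_ne_zero (qc_ne_zero q)
  refine mul_ne_zero (mul_ne_zero ?_ ?_) ?_
  · exact (prod_shift_ne_zero_iff (rowWtX_t11_eq_zero q) _ _).2 (by omega)
  · exact mul_ne_zero (pow_ne_zero _ (pow_ne_zero _ h)) (pow_ne_zero _ (pow_ne_zero _ h))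
  · exact (prod_shift_ne_zero_iff (colWt_star_t11_eq_zero q) _ _).2 (by omega)

/-- The linear map `ψ ↦ ∑ t₁₁^{i₁} t₁₂^{i₂} ψ_{i₁i₂j₁j₂}(x) t₁₂*^{j₂} t₁₁*^{j₁}`. -/
def sumXLin : (MIdx →₀ ℂ[X]) →ₗ[ℂ] PolX q :=
  Finsupp.lsum ℂ fun μ => LinearMap.mulRight ℂ (starX q (tX q .t11) ^ μ.j₁) ∘ₗ
    LinearMap.mulRight ℂ (starX q (tX q .t12) ^ μ.j₂) ∘ₗ
    LinearMap.mulLeft ℂ (tX q .t11 ^ μ.i₁ * tX q .t12 ^ μ.i₂) ∘ₗ (aeval (xX q)).toLinearMap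

theorem sumXLin_apply (ψ : MIdx →₀ ℂ[X]) : sumXLin q ψ = sumX q ψ := rfl

theorem sumX_single (μ : MIdx) (p : ℂ[X]) : sumX q (Finsupp.single μ p)
    = tX q .t11 ^ μ.i₁ * tX q .t12 ^ μ.i₂ * aeval (xX q) p *
      starX q (tX q .t12) ^ μ.j₂ * starX q (tX q .t11) ^ μ.j₁ := by
  rw [sumX, Finsupp.sum_single_index (by simp)]

-- As in the disc, t₁₁ and t₁₂ act on rows and their adjoints on columns of the identity matrix. The
-- monomial with index ν occupies a single diagonal in a single degree, and this pair determines ν.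
open Classical in
theorem leftX_monomial (μ ν : MIdx) (m : ℕ) (p : ℂ[X]) :
    leftX q (tX q .t11 ^ ν.i₁ * tX q .t12 ^ ν.i₂ * aeval (xX q) p *
      starX q (tX q .t12) ^ ν.j₂ * starX q (tX q .t11) ^ ν.j₁) (oneKer ℤ) (posX (μ, m))
      = if ν = μ then weightX q (μ, m) * p.eval ((qc q)⁻¹ ^ (2 * m)) else 0 := by
  rw [mul_assoc, map_mul, mul_apply_eq_comp, ← rightX_one, map_mul (rightX q),
    MulOpposite.unop_mul, unop_pow_eq, unop_pow_eq, rightX_star_t12, rightX_star_t11, map_mul,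
    map_mul, map_pow, map_pow, leftX_tX, leftX_tX, ← aeval_algHom_apply, leftX_xX, aeval_lop_diag,
    mul_apply_eq_comp, mul_apply_eq_comp, mul_apply_eq_comp, posX_apply]
  simp only [rowShiftX, rotDeg, lop_pred_pow]
  simp only [lop_id_pow, lop_apply, rop_pred_pow, rop_id_pow, id]
  split_ifs with h
  · subst h
    have h1 : oneKer ℤ (m + ν.i₁ - ν.i₁, m + ν.j₁ - ν.j₁, (ν.i₁ + ν.i₂ - ν.j₁ - ν.j₂ : ℤ)
        - ν.i₁ • 1 - ν.i₂ • 1 - 0 - ν.j₁ • (-1) - ν.j₂ • (-1)) = 1 := by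
      simp [oneKer]
      ring
    rw [h1]
    simp only [weightX, add_tsub_cancel_right, show rowWtX q .t12 = fun r => (qc q)⁻¹ ^ r from rfl]
    ring
  · by_cases h1 : ν.i₁ ≤ m + μ.i₁
    · by_cases h2 : ν.j₁ ≤ m + μ.j₁
      · have : ¬ (m + μ.i₁ - ν.i₁ = m + μ.j₁ - ν.j₁ ∧ ((μ.i₁ + μ.i₂ - μ.j₁ - μ.j₂ : ℤ) - ν.i₁
            - ν.i₂ - 0 + ν.j₁ + ν.j₂ = 0)) := by
          rintro ⟨h3, h4⟩
          apply h
          -- On a common diagonal and in a common degree, this shifted second coordinate puts ν at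
          -- the position of (μ, m); injectivity of `posX` then gives ν = μ.
          have : posX (ν, m + μ.i₁ - ν.i₁) = posX (μ, m) := by
            simp only [posX_apply, Prod.mk.injEq]
            omega
          exact congrArg Prod.fst (posX.injective this)
        simp only [oneKer, nsmul_eq_mul, mul_one, mul_neg, sub_neg_eq_add, this, if_false, mul_zero]
      · rw [not_not.1 (mt (prod_shift_ne_zero_iff (colWt_star_t11_eq_zero q) _ _).1 h2)]
        simp
    · rw [not_not.1 (mt (prod_shift_ne_zero_iff (rowWtX_t11_eq_zero q) _ _).1 h1)]
      simp

theorem leftX_sumX (ψ : MIdx →₀ ℂ[X]) (k : MIdx × ℕ) :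
    leftX q (sumX q ψ) (oneKer ℤ) (posX k)
      = weightX q k * (ψ k.1).eval ((qc q)⁻¹ ^ (2 * k.2)) := by
  classical
  obtain ⟨μ, m⟩ := k
  rw [sumX, Finsupp.sum, map_sum, sum_apply, Finset.sum_apply]
  simp only [leftX_monomial]
  rw [Finset.sum_ite_eq']
  split_ifs with h
  · rfl
  · rw [Finsupp.notMem_support_iff.1 h, eval_zero, mul_zero]

theorem qc_inv_pow_injective : Function.Injective fun m : ℕ => (qc q)⁻¹ ^ (2 * m) := by
  intro m n h
  simp only [inv_pow, inv_inj] at h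
  exact qc_pow_injective q h

theorem sumX_injective : Function.Injective (sumX q) := by
  intro ψ ψ' h
  refine Finsupp.ext fun μ => eq_of_eval_eq (qc_inv_pow_injective q) fun m => ?_
  have h1 := leftX_sumX q ψ (μ, m)
  rw [h, leftX_sumX] at h1
  exact (mul_left_cancel₀ (weightX_ne_zero q _) h1).symm

/-! Commutation relations between `t₁₁`, `t₁₂`, their adjoints and `x`. -/

theorem t12_t11 : tX q .t12 * tX q .t11 = (qc q)⁻¹ • (tX q .t11 * tX q .t12) := by
  rw [tX_r1, inv_smul_smul₀ (qc_ne_zero q)]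

theorem s12_t11 : starX q (tX q .t12) * tX q .t11
    = (qc q)⁻¹ • (tX q .t11 * starX q (tX q .t12)) := by
  rw [starX_t12, neg_mul, mul_neg, smul_mul_assoc, mul_smul_comm, tX_r3, smul_neg,
    inv_smul_smul₀ (qc_ne_zero q)]

theorem t12_s12 : Commute (tX q .t12) (starX q (tX q .t12)) := by
  rw [Commute, SemiconjBy, starX_t12, neg_mul, mul_neg, smul_mul_assoc, mul_smul_comm, tX_r5]

theorem s11_t12 : starX q (tX q .t11) * tX q .t12
    = (qc q)⁻¹ • (tX q .t12 * starX q (tX q .t11)) := by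
  rw [starX_t11, neg_mul, mul_neg, tX_r4, smul_neg, inv_smul_smul₀ (qc_ne_zero q)]

theorem s11_s12 : starX q (tX q .t11) * starX q (tX q .t12)
    = (qc q)⁻¹ • (starX q (tX q .t12) * starX q (tX q .t11)) := by
  rw [starX_t11, starX_t12, neg_mul_neg, neg_mul_neg, smul_mul_assoc, mul_smul_comm, tX_r2,
    inv_smul_smul₀ (qc_ne_zero q)]

theorem t11_s11 : tX q .t11 * starX q (tX q .t11) = xX q - 1 := by
  rw [xX, starX_t11, starX_t12, mul_neg, mul_neg, tX_r7, mul_smul_comm, tX_r5]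
  abel

theorem s11_t11 : starX q (tX q .t11) * tX q .t11 = ((qc q) ^ 2)⁻¹ • xX q - 1 := by
  have h := qc_ne_zero q
  rw [xX, starX_t11, starX_t12, neg_mul, tX_r6, mul_neg, mul_smul_comm, tX_r5]
  match_scalars <;> field_simp

theorem x_t12 : Commute (xX q) (tX q .t12) :=
  (Commute.refl _).mul_left (t12_s12 q).symm

theorem x_s12 : Commute (xX q) (starX q (tX q .t12)) :=
  (t12_s12 q).mul_left (Commute.refl _)

theorem x_t11 : xX q * tX q .t11 = ((qc q)⁻¹ ^ 2) • (tX q .t11 * xX q) := by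
  rw [xX, mul_assoc, s12_t11, mul_smul_comm, ← mul_assoc, t12_t11, smul_mul_assoc, smul_smul,
    mul_assoc, pow_two]

theorem t11_x : tX q .t11 * xX q = (qc q ^ 2) • (xX q * tX q .t11) := by
  rw [x_t11, inv_pow, smul_inv_smul₀ (pow_ne_zero _ (qc_ne_zero q))]

theorem s11_x : starX q (tX q .t11) * xX q
    = ((qc q)⁻¹ ^ 2) • (xX q * starX q (tX q .t11)) := by
  rw [xX, ← mul_assoc, s11_t12, smul_mul_assoc, mul_assoc, s11_s12, mul_smul_comm, smul_smul,
    ← mul_assoc, pow_two]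

theorem aeval_x_t12_pow (p : ℂ[X]) (n : ℕ) :
    aeval (xX q) p * tX q .t12 ^ n = tX q .t12 ^ n * aeval (xX q) p :=
  (semiconjBy_aeval ((x_t12 q).symm.pow_left n) p).symm

theorem aeval_x_s12_pow (p : ℂ[X]) (n : ℕ) :
    aeval (xX q) p * starX q (tX q .t12) ^ n = starX q (tX q .t12) ^ n * aeval (xX q) p :=
  (semiconjBy_aeval ((x_s12 q).symm.pow_left n) p).symm

/-! ### Spanning by normally ordered monomials on X̃ -/

/-- The monomial `t₁₁^i t₁₂^k p(x) t₁₂*^l t₁₁*^j`. -/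
def monX (i k : ℕ) (p : ℂ[X]) (l j : ℕ) : PolX q :=
  tX q .t11 ^ i * (tX q .t12 ^ k * (aeval (xX q) p *
    (starX q (tX q .t12) ^ l * starX q (tX q .t11) ^ j)))

/-- Since t₁₂ commutes with x, one has t₁₂ p(x) t₁₂* = p(x) x, which lowers the exponents of t₁₂ and
t₁₂* together until one is 0. -/
theorem monX_mem_of_mul_eq_zero {i j : ℕ} (hij : i * j = 0) (k l : ℕ) (p : ℂ[X]) :
    monX q i k p l j ∈ LinearMap.range (sumXLin q) := by
  have h0 : ∀ (k l : ℕ) (hkl : k * l = 0) (p : ℂ[X]),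
      monX q i k p l j ∈ LinearMap.range (sumXLin q) := fun k l hkl p =>
    ⟨Finsupp.single ⟨i, k, j, l, hij, hkl⟩ p, by
      rw [sumXLin_apply, sumX_single]
      simp only [monX, mul_assoc]⟩
  induction k generalizing l p with
  | zero => exact h0 0 l (zero_mul l) p
  | succ k ih =>
    rcases l with _ | l
    · exact h0 (k + 1) 0 (mul_zero _) p
    · have h : monX q i (k + 1) p (l + 1) j = monX q i k (p * X) l j := by
        have e : tX q .t12 * (aeval (xX q) p * starX q (tX q .t12)) = aeval (xX q) (p * X) := by
          have := aeval_x_t12_pow q p 1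
          rw [pow_one] at this
          rw [← mul_assoc, ← this, mul_assoc, map_mul, aeval_X, xX]
        rw [monX, monX, ← e, pow_succ, pow_succ' (starX q (tX q .t12))]
        simp only [mul_assoc]
      rw [h]
      exact ih _ _

/-- The last t₁₁ is carried to the right until it meets t₁₁*, and t₁₁ t₁₁* = x - 1. On the way it
picks up q^{k+l} and replaces p(x) by p(q² x); both outer exponents drop by 1. -/
theorem monX_mem (i k l j : ℕ) (p : ℂ[X]) :
    monX q i k p l j ∈ LinearMap.range (sumXLin q) := by
  induction i generalizing j p with
  | zero => exact monX_mem_of_mul_eq_zero q (zero_mul j) k l p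
  | succ i ih =>
    rcases j with _ | j
    · exact monX_mem_of_mul_eq_zero q (mul_zero _) k l p
    · have hk : tX q .t11 * tX q .t12 ^ k = qc q ^ k • (tX q .t12 ^ k * tX q .t11) :=
        mul_pow_comm_smul (tX_r1 q) k
      have hl : tX q .t11 * starX q (tX q .t12) ^ l
          = qc q ^ l • (starX q (tX q .t12) ^ l * tX q .t11) := by
        refine mul_pow_comm_smul ?_ l
        rw [s12_t11, smul_inv_smul₀ (qc_ne_zero q)]
      have e : monX q (i + 1) k p l (j + 1) = qc q ^ (k + l) •
          monX q i k (p.comp (C (qc q ^ 2) * X) * (X - 1)) l j := by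
        have e1 : aeval (xX q) (X - 1 : ℂ[X]) = tX q .t11 * starX q (tX q .t11) := by
          rw [t11_s11, map_sub, aeval_X, map_one]
        calc monX q (i + 1) k p l (j + 1)
            = tX q .t11 ^ i * ((tX q .t11 * tX q .t12 ^ k) * (aeval (xX q) p *
                (starX q (tX q .t12) ^ l *
                  (starX q (tX q .t11) * starX q (tX q .t11) ^ j)))) := by
              rw [monX, pow_succ, pow_succ' (starX q (tX q .t11))]
              simp only [mul_assoc]
          _ = qc q ^ k • (tX q .t11 ^ i * (tX q .t12 ^ k * ((tX q .t11 * aeval (xX q) p) *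
                (starX q (tX q .t12) ^ l *
                  (starX q (tX q .t11) * starX q (tX q .t11) ^ j))))) := by
              rw [hk]
              simp only [smul_mul_assoc, mul_smul_comm, mul_assoc]
          _ = qc q ^ k • (tX q .t11 ^ i * (tX q .t12 ^ k *
                (aeval (xX q) (p.comp (C (qc q ^ 2) * X)) * ((tX q .t11 *
                starX q (tX q .t12) ^ l) *
                  (starX q (tX q .t11) * starX q (tX q .t11) ^ j))))) := by
              rw [mul_aeval_comm (t11_x q)]
              simp only [mul_assoc]
          _ = qc q ^ (k + l) • (tX q .t11 ^ i * (tX q .t12 ^ k *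
                (aeval (xX q) (p.comp (C (qc q ^ 2) * X)) * (starX q (tX q .t12) ^ l *
                  (aeval (xX q) (X - 1 : ℂ[X]) * starX q (tX q .t11) ^ j))))) := by
              rw [hl, e1, pow_add, mul_smul]
              simp only [smul_mul_assoc, mul_smul_comm, mul_assoc]
          _ = _ := by
              rw [monX, map_mul, ← mul_assoc (starX q (tX q .t12) ^ l), ← aeval_x_s12_pow]
              simp only [mul_assoc]
      rw [e]
      exact Submodule.smul_mem _ _ (ih _ _)

theorem t12_monX (i k l j : ℕ) (p : ℂ[X]) :
    tX q .t12 * monX q i k p l j = (qc q)⁻¹ ^ i • monX q i (k + 1) p l j := by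
  rw [monX, ← mul_assoc, mul_pow_comm_smul (t12_t11 q) i, monX, pow_succ']
  simp only [smul_mul_assoc, mul_assoc]

theorem s12_monX (i k l j : ℕ) (p : ℂ[X]) :
    starX q (tX q .t12) * monX q i k p l j = (qc q)⁻¹ ^ i • monX q i k p (l + 1) j := by
  have h1 := (t12_s12 q).symm.pow_right k
  have h2 := aeval_x_s12_pow q p 1
  rw [pow_one] at h2
  rw [monX, ← mul_assoc, mul_pow_comm_smul (s12_t11 q) i, smul_mul_assoc, mul_assoc,
    ← mul_assoc _ (_ ^ k), h1.eq, mul_assoc (_ ^ k), ← mul_assoc _ (aeval _ _), ← h2, monX,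
    pow_succ']
  simp only [mul_assoc]

theorem s11_monX_zero (k l j : ℕ) (p : ℂ[X]) : starX q (tX q .t11) * monX q 0 k p l j
    = (qc q)⁻¹ ^ (k + l) • monX q 0 k (p.comp (C ((qc q)⁻¹ ^ 2) * X)) l (j + 1) := by
  rw [monX, pow_zero, one_mul, ← mul_assoc, mul_pow_comm_smul (s11_t12 q) k, smul_mul_assoc,
    mul_assoc, ← mul_assoc _ (aeval _ _), mul_aeval_comm (s11_x q), mul_assoc (aeval _ _),
    ← mul_assoc _ (_ ^ l), mul_pow_comm_smul (s11_s12 q) l, monX, pow_zero, one_mul,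
    pow_succ' _ j, pow_add, mul_smul]
  simp only [smul_mul_assoc, mul_smul_comm, mul_assoc]

/-- The factor t₁₁* t₁₁ = q⁻² x - 1 is moved through the remaining t₁₁^i, which rescales x by
q^{-2i}. -/
theorem s11_monX_succ (i k l j : ℕ) (p : ℂ[X]) : starX q (tX q .t11) * monX q (i + 1) k p l j
    = monX q i k ((C (qc q ^ 2)⁻¹ * X - 1).comp (C (((qc q)⁻¹ ^ 2) ^ i) * X) * p) l j := by
  have e1 : starX q (tX q .t11) * tX q .t11 = aeval (xX q) (C (qc q ^ 2)⁻¹ * X - 1) := by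
    rw [s11_t11, map_sub, map_mul, aeval_C, aeval_X, map_one, Algebra.smul_def]
  rw [monX, pow_succ', mul_assoc, ← mul_assoc (starX q _), e1, ← mul_assoc,
    aeval_mul_comm (mul_pow_comm_smul (x_t11 q) i), mul_assoc, ← mul_assoc (aeval _ _),
    aeval_x_t12_pow, monX, map_mul]
  simp only [mul_assoc]

/-- Up to scalars t₂₁ and t₂₂ are the adjoints of t₁₂ and t₁₁. Left multiplication by t₁₁, t₁₂ and
the two adjoints turns one `monX` into a multiple of another, and every `monX` lies in the range. -/
theorem sumX_surjective : Function.Surjective (sumX q) := by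
  have h : LinearMap.range (sumXLin q) = ⊤ := by
    refine submodule_eq_top_of_generators (adjoin_tX q) _ ?_ ?_
    · have := monX_mem q 0 0 0 0 1
      simpa [monX] using this
    · rintro g _ ⟨ψ, rfl⟩
      induction ψ using Finsupp.induction_linear with
      | zero => simp
      | add ψ ψ' h h' => rw [map_add, mul_add]; exact Submodule.add_mem _ h h'
      | single μ p =>
        have e : sumXLin q (Finsupp.single μ p) = monX q μ.i₁ μ.i₂ p μ.j₂ μ.j₁ := by
          rw [sumXLin_apply, sumX_single, monX]
          simp only [mul_assoc]
        rw [e]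
        generalize μ.i₁ = i
        generalize μ.i₂ = k
        generalize μ.j₁ = j
        generalize μ.j₂ = l
        cases g with
        | t11 =>
          have : tX q .t11 * monX q i k p l j = monX q (i + 1) k p l j := by
            rw [monX, monX, pow_succ', mul_assoc]
          rw [this]
          exact monX_mem q _ _ _ _ _
        | t12 =>
          rw [t12_monX]
          exact Submodule.smul_mem _ _ (monX_mem q _ _ _ _ _)
        | t21 =>
          have : tX q .t21 = -((qc q)⁻¹ • starX q (tX q .t12)) := by
            rw [starX_t12, smul_neg, neg_neg, inv_smul_smul₀ (qc_ne_zero q)]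
          rw [this, neg_mul, smul_mul_assoc, s12_monX]
          exact Submodule.neg_mem _ (Submodule.smul_mem _ _
            (Submodule.smul_mem _ _ (monX_mem q _ _ _ _ _)))
        | t22 =>
          have : tX q .t22 = -starX q (tX q .t11) := by rw [starX_t11, neg_neg]
          rw [this, neg_mul]
          refine Submodule.neg_mem _ ?_
          rcases i with _ | i
          · rw [s11_monX_zero]
            exact Submodule.smul_mem _ _ (monX_mem q _ _ _ _ _)
          · rw [s11_monX_succ]
            exact monX_mem q _ _ _ _ _
  exact fun f => LinearMap.range_eq_top.1 h f

theorem coordX_sumX (ψ : MIdx →₀ ℂ[X]) (k : MIdx × ℕ) :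
    coordX q (sumX q ψ) k = (ψ k.1).eval ((qc q)⁻¹ ^ (2 * k.2)) := by
  rw [coordX, Function.leftInverse_invFun (sumX_injective q)]

theorem denseRange_coordX : DenseRange (coordX q) := by
  have h := denseRange_evalFamily (ι := MIdx) (qc_inv_pow_injective q)
  refine Dense.mono ?_ h
  rintro _ ⟨ψ, rfl⟩
  exact ⟨sumX q ψ, funext fun k => coordX_sumX q ψ k⟩

/-- The realization of the quantum principal homogeneous space by graded matrices. -/
def realX : Realization (coordX q) ℤ where
  toKer := rescale posX (weightX q) (weightX_ne_zero q)
  L := leftX q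
  R := rightX q
  L_comm := left_comm_of_generators (adjoin_tX q) (fun g => ⟨_, _, _, leftX_tX q g⟩)
  R_comm := right_comm_of_generators (adjoin_tX q) (fun g => ⟨_, _, _, rightX_tX q g⟩)
  R_one := rightX_one q
  toKer_coord a := by
    obtain ⟨ψ, rfl⟩ := sumX_surjective q a
    funext p
    obtain ⟨k, rfl⟩ := posX.surjective p
    rw [rescale_apply, coordX_sumX, leftX_sumX]
  dense := denseRange_coordX q

/-! ### Action, involution and rotations on X̃ -/

/-- The rotation degree. -/
abbrev degX : ℤ →+ ℤ := AddMonoidHom.id ℤ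

/-- The weights of the generators of `Pol(X̃)_q`. -/
def genWtX : GenX → ℤ
  | .t11 => 1
  | .t12 => -1
  | .t21 => 1
  | .t22 => -1

/-- Although z and z* do not belong to Pol(X̃)_q, they act on graded matrices in degree 0, and
twisted commutators with them reproduce X^± on the t_{ij}. -/
theorem actDistX_eq (ξ : UqGen) (F : DistXt) :
    actDistX q ξ F = (realX q).toKer.symm (actKer q degX ξ ((realX q).toKer F)) := by
  have hs := sq_ne_zero q
  have hq : 1 - sq q ^ 4 ≠ 0 := by
    have h := qc_pow_ne_one q two_ne_zero
    rwa [qc_eq, ← pow_mul] at h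
  refine (realX q).contExt_eq (S := actKer q degX ξ) (actKer q degX ξ).continuous (fun a => ?_) F
  have key := (realX q).act_of_shifts (adjoin_tX q) q degX (k := genWtX) (leftX_tX q)
    (H := HHomX q) (K := KHomX q) (Kinv := KinvHomX q) (Xp := XpHomX q) (Xm := XmHomX q)
    ?_ ?_ ?_ (fun g => liftX_tX q _ _ g) (fun g => liftX_tX q _ _ g) (fun g => liftX_tX q _ _ g)
    (fun g => liftX_tX q _ _ g) (fun g => liftX_tX q _ _ g) ?_ ?_ ξ a
  · rw [← key]
    cases ξ <;> rfl
  · intro g r hr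
    cases g with
    | t11 =>
      rcases r with _ | r
      · exact absurd (by simp [rowWtX]) hr
      · simp [rowShiftX, genWtX, rotDeg]
    | _ => simp [rowShiftX, genWtX, rotDeg]
  · intro g
    cases g <;> simp [kX, genWtX]
  · intro g
    cases g <;> simp [wtX, genWtX]
  · intro g
    change _ = leftX q (xpX q g)
    refine ContinuousLinearMap.ext fun F => funext fun ⟨r, s, b⟩ => ?_
    cases g <;> rcases r with _ | _ | r <;>
    simp [xpX, leftX_tX, rowWtX, rowShiftX, genWtX, rotDeg, lop_apply, zL, qc_eq] <;>
    first | (field_simp <;> ring1) | (refine Or.inr ?_; field_simp <;> ring1)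
  · intro g
    change _ = leftX q (xmX q g)
    refine ContinuousLinearMap.ext fun F => funext fun ⟨r, s, b⟩ => ?_
    cases g <;> rcases r with _ | _ | r <;>
    simp [xmX, leftX_tX, rowWtX, rowShiftX, genWtX, rotDeg, lop_apply, zsL, qc_eq] <;>
    first | (field_simp <;> ring1) | (refine Or.inr ?_; field_simp <;> ring1)

theorem starDistX_eq (F : DistXt) :
    starDistX q F = (realX q).toKer.symm (starKer q ((realX q).toKer F)) := by
  have hq := qc_ne_zero q
  refine (realX q).contExt_eq (continuous_starKer q) (fun a => ?_) F
  refine (realX q).star_of_generators q (adjoin_tX q) (starHomX q) (fun g F => ?_) a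
  change starKer q (leftX q _ F) = (rightX q (starX q _)).unop _
  rw [starX_tX, leftX_tX]
  cases g with
  | t11 =>
    rw [starGenX, map_neg, MulOpposite.unop_neg, rightX_tX,
      starKer_lop (w' := fun s => -colWtX q .t22 s)]
    · funext ⟨r, s, b⟩
      simp [rop_apply, colShiftX, rowShiftX, rotDeg]
    · intro s
      rcases s with _ | s
      · simp [rowWtX, colWtX]
      · simp [rowWtX, colWtX, rowShiftX, normSq_succ, conj_qc]
        ring
  | t12 =>
    rw [starGenX, map_neg, map_smul, MulOpposite.unop_neg, MulOpposite.unop_smul, rightX_tX,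
      starKer_lop (w' := fun s => -(qc q * colWtX q .t21 s))]
    · funext ⟨r, s, b⟩
      simp [rop_apply, colShiftX, rowShiftX, rotDeg, mul_assoc]
    · intro s
      simp [rowWtX, colWtX, rowShiftX, conj_qc, pow_succ]
      field_simp
  | t21 =>
    rw [starGenX, map_neg, map_smul, MulOpposite.unop_neg, MulOpposite.unop_smul, rightX_tX,
      starKer_lop (w' := fun s => -((qc q)⁻¹ * colWtX q .t12 s))]
    · funext ⟨r, s, b⟩
      simp [rop_apply, colShiftX, rowShiftX, rotDeg, mul_assoc]
    · intro s
      simp [rowWtX, colWtX, rowShiftX, conj_qc, pow_succ]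
      ring
  | t22 =>
    rw [starGenX, map_neg, MulOpposite.unop_neg, rightX_tX,
      starKer_lop (w' := fun s => -colWtX q .t11 s)]
    · funext ⟨r, s, b⟩
      simp [rop_apply, colShiftX, rowShiftX, rotDeg]
    · intro s
      simp [rowWtX, colWtX, rowShiftX, normSq_succ, conj_qc]
      ring

/-- The rotations on graded matrices. -/
def rotKer (φ : ℝ) : Ker ℤ →L[ℂ] Ker ℤ :=
  wcomp (fun p => Complex.exp (φ * Complex.I) ^ p.2.2) id

theorem rotDistX_eq (φ : ℝ) (F : DistXt) :
    rotDistX q φ F = (realX q).toKer.symm (rotKer φ ((realX q).toKer F)) := by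
  refine (realX q).contExt_eq (S := rotKer φ) (rotKer φ).continuous (fun a => ?_) F
  refine (realX q).hom_of_generators (adjoin_tX q) (rotX q φ) (fun g => ?_) ?_ a
  · rw [rotX, liftX_tX, map_smul]
    change _ * leftX q _ = _ • leftX q _ * _
    rw [leftX_tX]
    have he := Complex.exp_ne_zero (φ * Complex.I)
    refine ContinuousLinearMap.ext fun F => funext fun ⟨r, s, b⟩ => ?_
    have h : phaseX φ g = Complex.exp (φ * Complex.I) ^ rotDeg g := by
      cases g <;> simp [phaseX, rotDeg, Complex.exp_neg]
    simp only [mul_apply_eq_comp, smul_apply, Pi.smul_apply, rotKer, wcomp_apply, lop_apply,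
      smul_eq_mul, id, h]
    rw [zpow_sub₀ he]
    field_simp
  · rw [rotKer, wcomp_id_one (c := 1) (by simp), one_smul]

/-- A graded matrix is invariant under rotations iff it is homogeneous of degree `0`. -/
theorem rotKer_fixed_iff (F : Ker ℤ) :
    (∀ φ : ℝ, rotKer φ F = F) ↔ ∀ r s b, b ≠ 0 → F (r, s, b) = 0 := by
  constructor
  · intro h r s b hb
    have hb' : (b : ℂ) ≠ 0 := by exact_mod_cast hb
    -- The angle π / b is chosen so that the rotation multiplies entries of degree b by -1.
    have h1 := congrFun (h (Real.pi / b)) (r, s, b)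
    have h2 : Complex.exp (((Real.pi / b : ℝ) : ℂ) * Complex.I) ^ b = -1 := by
      rw [← Complex.exp_int_mul, ← Complex.exp_pi_mul_I]
      congr 1
      push_cast
      field_simp
    simp only [rotKer, wcomp_apply, id, h2] at h1
    have h3 : (2 : ℂ) * F (r, s, b) = 0 := by linear_combination -h1
    simpa using h3
  · intro h φ
    funext ⟨r, s, b⟩
    by_cases hb : b = 0
    · simp [rotKer, hb]
    · simp [rotKer, h r s b hb]

theorem rotDistX_fixed_iff (F : DistXt) : (∀ φ : ℝ, rotDistX q φ F = F) ↔
    ∀ r s b, b ≠ 0 → (realX q).toKer F (r, s, b) = 0 := by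
  rw [← rotKer_fixed_iff]
  refine forall_congr' fun φ => ?_
  rw [rotDistX_eq, ContinuousLinearEquiv.symm_apply_eq]

end Homogeneous

/-! ### The homogeneous part of degree zero -/

section DegreeZero

variable (q : Param)

/-- The embedding of indices of ungraded matrices as indices of degree `0`. -/
def embZero : ℕ × ℕ × Unit ↪ ℕ × ℕ × ℤ where
  toFun p := (p.1, p.2.1, 0)
  inj' p p' h := by
    simp only [Prod.mk.injEq, and_true] at h
    exact Prod.ext h.1 (Prod.ext h.2 rfl)

@[simp] theorem embZero_apply (r s : ℕ) (u : Unit) : embZero (r, s, u) = (r, s, 0) := rfl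

/-- Ungraded matrices as graded matrices of degree `0`. -/
def inclZero : Ker Unit →L[ℂ] Ker ℤ :=
  wcomp (fun p => if p.2.2 = 0 then 1 else 0) (fun p => (p.1, p.2.1, ()))

/-- The component of degree `0` of a graded matrix. -/
def compZero : Ker ℤ →L[ℂ] Ker Unit := wcomp (fun _ => 1) embZero

theorem inclZero_zero (F : Ker Unit) (r s : ℕ) : inclZero F (r, s, 0) = F (r, s, ()) := by
  simp [inclZero]

theorem inclZero_of_ne (F : Ker Unit) (r s : ℕ) {b : ℤ} (hb : b ≠ 0) :
    inclZero F (r, s, b) = 0 := by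
  simp [inclZero, hb]

theorem compZero_inclZero (F : Ker Unit) : compZero (inclZero F) = F := by
  funext ⟨r, s, b⟩
  simp [compZero, inclZero_zero]

theorem inclZero_compZero {F : Ker ℤ} (h : ∀ r s b, b ≠ 0 → F (r, s, b) = 0) :
    inclZero (compZero F) = F := by
  funext ⟨r, s, b⟩
  by_cases hb : b = 0
  · subst hb
    simp [compZero, inclZero_zero]
  · rw [inclZero_of_ne _ _ _ hb, h r s b hb]

theorem support_inclZero (F : Ker Unit) :
    (inclZero F).support = embZero '' F.support := by
  ext ⟨r, s, b⟩
  constructor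
  · intro h
    have hb : b = 0 := by
      by_contra hb
      exact h (inclZero_of_ne F r s hb)
    subst hb
    exact ⟨(r, s, ()), by simpa [inclZero_zero] using h, rfl⟩
  · rintro ⟨⟨r', s', _⟩, h, h'⟩
    simp only [embZero_apply, Prod.mk.injEq] at h'
    obtain ⟨rfl, rfl, rfl⟩ := h'
    simpa [inclZero_zero] using h

/-- In degree 0 both weights equal 2(r - s), and multiplication by z or z* preserves the degree; in
other degrees both sides vanish. -/
theorem inclZero_actKer (ξ : UqGen) (F : Ker Unit) :
    inclZero (actKer q degU ξ F) = actKer q degX ξ (inclZero F) := by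
  funext ⟨r, s, b⟩
  by_cases hb : b = 0
  · subst hb
    rw [inclZero_zero]
    cases ξ <;>
    simp [actKer, opH, opK, opKinv, opXp, opXm, zL, zR, zsL, zsR, lop_apply, rop_apply, wt,
      inclZero_zero]
  · rw [inclZero_of_ne _ _ _ hb]
    cases ξ <;>
    simp [actKer, opH, opK, opKinv, opXp, opXm, zL, zR, zsL, zsR, lop_apply, rop_apply,
      inclZero_of_ne _ _ _ hb]

theorem inclZero_starKer (F : Ker Unit) : inclZero (starKer q F) = starKer q (inclZero F) := by
  funext ⟨r, s, b⟩
  by_cases hb : b = 0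
  · subst hb
    rw [inclZero_zero, starKer_apply, starKer_apply, neg_zero (G := ℤ), inclZero_zero]
  · rw [inclZero_of_ne _ _ _ hb, starKer_apply, inclZero_of_ne _ _ _ (neg_ne_zero.2 hb), map_zero,
      mul_zero]

theorem inclZero_runit (p : ℕ × ℕ × Unit) (F : Ker Unit) :
    inclZero (runit p F) = runit (embZero p) (inclZero F) := by
  funext ⟨r, s, b⟩
  obtain ⟨r', s', u⟩ := p
  by_cases hb : b = 0
  · subst hb
    simp only [inclZero_zero, runit, rop_apply, embZero_apply, sub_zero]
    rfl
  · simp [inclZero_of_ne _ _ _ hb, runit, rop_apply]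

theorem inclZero_lunit (p : ℕ × ℕ × Unit) (F : Ker Unit) :
    inclZero (lunit p F) = lunit (embZero p) (inclZero F) := by
  funext ⟨r, s, b⟩
  obtain ⟨r', s', u⟩ := p
  by_cases hb : b = 0
  · subst hb
    simp only [inclZero_zero, lunit, lop_apply, embZero_apply, sub_zero]
    rfl
  · simp [inclZero_of_ne _ _ _ hb, lunit, lop_apply]

theorem inclZero_rmulFin (S : Finset (ℕ × ℕ × Unit)) (g F : Ker Unit) :
    inclZero (rmulFin S g F) = rmulFin (S.map embZero) (inclZero g) (inclZero F) := by
  simp only [rmulFin, Finset.sum_map, sum_apply, smul_apply, map_sum, map_smul, inclZero_runit]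
  exact Finset.sum_congr rfl fun p _ => by rw [← inclZero_zero g p.1 p.2.1]; rfl

theorem inclZero_lmulFin (S : Finset (ℕ × ℕ × Unit)) (g F : Ker Unit) :
    inclZero (lmulFin S g F) = lmulFin (S.map embZero) (inclZero g) (inclZero F) := by
  simp only [lmulFin, Finset.sum_map, sum_apply, smul_apply, map_sum, map_smul, inclZero_lunit]
  exact Finset.sum_congr rfl fun p _ => by rw [← inclZero_zero g p.1 p.2.1]; rfl

end DegreeZero

/-! ### The isomorphism of distributions -/

section Iso

variable (q : Param)

theorem finite_support_toKerU (F : DistU) :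
    ((realU q).toKer F).support.Finite ↔ F.support.Finite :=
  finite_support_rescale posU (weightU q) (weightU_ne_zero q) F

theorem finite_support_toKerX (F : DistXt) :
    ((realX q).toKer F).support.Finite ↔ F.support.Finite :=
  finite_support_rescale posX (weightX q) (weightX_ne_zero q) F

/-- The map of distributions, with values in the distributions on `X̃`. -/
def distMap : DistU →L[ℂ] DistXt :=
  ((realX q).toKer.symm : Ker ℤ →L[ℂ] DistXt) ∘L inclZero ∘L
    ((realU q).toKer : DistU →L[ℂ] Ker Unit)

theorem toKer_distMap (F : DistU) :
    (realX q).toKer (distMap q F) = inclZero ((realU q).toKer F) :=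
  (realX q).toKer.apply_symm_apply _

theorem distMap_toKer_symm (F : Ker Unit) :
    distMap q ((realU q).toKer.symm F) = (realX q).toKer.symm (inclZero F) := by
  change (realX q).toKer.symm (inclZero ((realU q).toKer ((realU q).toKer.symm F))) = _
  rw [ContinuousLinearEquiv.apply_symm_apply]

theorem distMap_fixed (F : DistU) (φ : ℝ) : rotDistX q φ (distMap q F) = distMap q F :=
  (rotDistX_fixed_iff q _).2 (fun r s b hb => by
    rw [toKer_distMap, inclZero_of_ne _ _ _ hb]) φ

/-- The isomorphism `D(U)'_q ≃ D(X)'_q`. -/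
def distIso : DistU ≃ₜ DistX q where
  toFun F := ⟨distMap q F, distMap_fixed q F⟩
  invFun G := (realU q).toKer.symm (compZero ((realX q).toKer G.1))
  left_inv F := by
    change (realU q).toKer.symm (compZero ((realX q).toKer (distMap q F))) = F
    rw [toKer_distMap, compZero_inclZero, ContinuousLinearEquiv.symm_apply_apply]
  right_inv G := by
    refine Subtype.ext ?_
    change distMap q _ = G.1
    rw [distMap_toKer_symm, inclZero_compZero ((rotDistX_fixed_iff q _).1 G.2),
      ContinuousLinearEquiv.symm_apply_apply]
  continuous_toFun := (distMap q).continuous.subtype_mk _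
  continuous_invFun := by
    have h : Continuous fun G : DistX q => G.1 := continuous_subtype_val
    exact (realU q).toKer.symm.continuous.comp
      (compZero.continuous.comp ((realX q).toKer.continuous.comp h))

theorem finite_support_distMap (F : DistU) :
    (distMap q F).support.Finite ↔ F.support.Finite := by
  rw [← finite_support_toKerX, toKer_distMap, support_inclZero,
    Set.finite_image_iff embZero.injective.injOn, finite_support_toKerU]

/-- The isomorphism `D(U)_q ≃ D(X)_q`. -/
def finIso : FinU ≃ FinX q where
  toFun f := ⟨distMap q f.1, (finite_support_distMap q _).2 f.2, distMap_fixed q f.1⟩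
  invFun g := ⟨(distIso q).symm ⟨g.1, g.2.2⟩, by
    refine (finite_support_distMap q _).1 ?_
    have h := (distIso q).apply_symm_apply ⟨g.1, g.2.2⟩
    have h' : distMap q ((distIso q).symm ⟨g.1, g.2.2⟩) = g.1 := congrArg Subtype.val h
    rw [h']
    exact g.2.1⟩
  left_inv f := Subtype.ext ((distIso q).symm_apply_apply f.1)
  right_inv g := by
    have h := (distIso q).apply_symm_apply ⟨g.1, g.2.2⟩
    have h' : distMap q ((distIso q).symm ⟨g.1, g.2.2⟩) = g.1 := congrArg Subtype.val h
    exact Subtype.ext h'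

theorem distMap_actDistU (ξ : UqGen) (F : DistU) :
    distMap q (actDistU q ξ F) = actDistX q ξ (distMap q F) := by
  rw [actDistU_eq, actDistX_eq, distMap_toKer_symm, inclZero_actKer, toKer_distMap]

theorem distMap_starDistU (F : DistU) :
    distMap q (starDistU q F) = starDistX q (distMap q F) := by
  rw [starDistU_eq, starDistX_eq, distMap_toKer_symm, inclZero_starKer, toKer_distMap]

theorem support_toKer_distMap_subset {g : DistU} {S : Finset (ℕ × ℕ × Unit)}
    (hS : ((realU q).toKer g).support ⊆ S) :
    ((realX q).toKer (distMap q g)).support ⊆ S.map embZero := by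
  rw [toKer_distMap, support_inclZero, Finset.coe_map]
  exact Set.image_mono hS

theorem distMap_distMul (F : DistU) {g : DistU} (hg : g.support.Finite) :
    distMap q (distMul (coordU q) F g) = distMul (coordX q) (distMap q F) (distMap q g) := by
  have hS := ((finite_support_toKerU q g).2 hg).coe_toFinset.ge
  rw [(realU q).distMul_eq F hS,
    (realX q).distMul_eq (distMap q F) (support_toKer_distMap_subset q hS), distMap_toKer_symm,
    inclZero_rmulFin, toKer_distMap, toKer_distMap]

theorem distMap_mulDist {g : DistU} (hg : g.support.Finite) (F : DistU) :
    distMap q (mulDist (coordU q) g F) = mulDist (coordX q) (distMap q g) (distMap q F) := by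
  have hS := ((finite_support_toKerU q g).2 hg).coe_toFinset.ge
  rw [(realU q).mulDist_eq hS,
    (realX q).mulDist_eq (support_toKer_distMap_subset q hS), distMap_toKer_symm,
    inclZero_lmulFin, toKer_distMap, toKer_distMap]

/-! The product, the involution and the action preserve finite functions. -/

/-- The bounds make every fibre of `σ` finite, so the preimage of a finite support is finite. They
allow one predecessor step, which is all that X^± need. -/
theorem wcomp_mem_finDist {w : ℕ × ℕ × Unit → ℂ} {σ : ℕ × ℕ × Unit → ℕ × ℕ × Unit}
    (h : ∀ p, p.1 ≤ (σ p).1 + 1 ∧ p.2.1 ≤ (σ p).2.1 + 1) {F : Ker Unit}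
    (hF : F ∈ finDist (ℕ × ℕ × Unit)) : wcomp w σ F ∈ finDist (ℕ × ℕ × Unit) := by
  have hF' : F.support.Finite := hF
  refine (hF'.preimage' (f := σ) fun p _ => ?_).subset fun x hx h0 => hx ?_
  · refine ((Set.finite_Iic (p.1 + 1)).prod
      ((Set.finite_Iic (p.2.1 + 1)).prod Set.finite_univ)).subset ?_
    rintro x rfl
    exact ⟨(h x).1, (h x).2, trivial⟩
  · rw [wcomp_apply, h0, mul_zero]

theorem actKer_mem_finDist (ξ : UqGen) {F : Ker Unit} (hF : F ∈ finDist (ℕ × ℕ × Unit)) :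
    actKer q degU ξ F ∈ finDist (ℕ × ℕ × Unit) := by
  have hid : ∀ w : ℕ × ℕ × Unit → ℂ, wcomp w id F ∈ finDist (ℕ × ℕ × Unit) := fun w =>
    wcomp_mem_finDist (by simp) hF
  cases ξ with
  | H => exact hid _
  | K => exact hid _
  | Kinv => exact hid _
  | Xp =>
    refine Submodule.smul_mem _ _ (Submodule.sub_mem _ ?_ ?_) <;>
    refine wcomp_mem_finDist (fun p => ?_) (hid _) <;> simp <;> omega
  | Xm =>
    refine Submodule.smul_mem _ _ (Submodule.sub_mem _ ?_ ?_) <;>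
    refine wcomp_mem_finDist (fun p => ?_) (hid _) <;> simp <;> omega

theorem starKer_mem_finDist {F : Ker Unit} (hF : F ∈ finDist (ℕ × ℕ × Unit)) :
    starKer q F ∈ finDist (ℕ × ℕ × Unit) := by
  have hF' : F.support.Finite := hF
  refine (hF'.image fun p => (p.2.1, p.1, p.2.2)).subset fun x hx => ?_
  refine ⟨(x.2.1, x.1, x.2.2), fun h0 => hx ?_, rfl⟩
  change _ * (starRingEnd ℂ) (F (x.2.1, x.1, x.2.2)) = 0
  rw [h0, map_zero, mul_zero]

theorem runit_mem_finDist (p : ℕ × ℕ × Unit) {F : Ker Unit} (hF : F ∈ finDist (ℕ × ℕ × Unit)) :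
    runit p F ∈ finDist (ℕ × ℕ × Unit) := by
  have hF' : F.support.Finite := hF
  refine (hF'.image fun x => (x.1, p.2.1, ())).subset fun x hx => ?_
  obtain ⟨r, s, u⟩ := x
  have h : (if s = p.2.1 then (1 : ℂ) else 0) * F (r, p.1, u - p.2.2) ≠ 0 := by
    rw [Function.mem_support, runit, rop_apply] at hx
    convert hx
  refine ⟨(r, p.1, u - p.2.2), right_ne_zero_of_mul h, ?_⟩
  have hs : s = p.2.1 := by
    by_contra hs
    simp [hs] at h
  rw [hs]

theorem toKerU_symm_mem {F : Ker Unit} (hF : F ∈ finDist (ℕ × ℕ × Unit)) :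
    (realU q).toKer.symm F ∈ FinU := by
  refine (finite_support_toKerU q _).1 ?_
  rw [ContinuousLinearEquiv.apply_symm_apply]
  exact hF

theorem actDistU_mem (ξ : UqGen) {f : DistU} (hf : f ∈ FinU) : actDistU q ξ f ∈ FinU := by
  rw [actDistU_eq]
  exact toKerU_symm_mem q (actKer_mem_finDist q ξ ((finite_support_toKerU q f).2 hf))

theorem starDistU_mem {f : DistU} (hf : f ∈ FinU) : starDistU q f ∈ FinU := by
  rw [starDistU_eq]
  exact toKerU_symm_mem q (starKer_mem_finDist q ((finite_support_toKerU q f).2 hf))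

theorem distMulU_mem {f g : DistU} (hf : f ∈ FinU) (hg : g ∈ FinU) :
    distMul (coordU q) f g ∈ FinU := by
  rw [(realU q).distMul_eq f ((finite_support_toKerU q g).2 hg).coe_toFinset.ge]
  refine toKerU_symm_mem q ?_
  rw [rmulFin, sum_apply]
  exact Submodule.sum_mem _ fun p _ => Submodule.smul_mem _ _
    (runit_mem_finDist p ((finite_support_toKerU q f).2 hf))

theorem isCovariantStarIso_finIso : IsCovariantStarIso q (finIso q) where
  map_add f g := map_add (distMap q) f.1 g.1
  map_smul c f := map_smul (distMap q) c f.1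
  map_mul f g := ⟨⟨_, distMulU_mem q f.2 g.2⟩, rfl, distMap_distMul q f.1 g.2⟩
  map_star f := ⟨⟨_, starDistU_mem q f.2⟩, rfl, distMap_starDistU q f.1⟩
  map_act ξ f := ⟨⟨_, actDistU_mem q ξ f.2⟩, rfl, distMap_actDistU q ξ f.1⟩

open Classical in
theorem toKer_f0 : (realU q).toKer f0.1 = Pi.single (0, 0, ()) 1 := by
  funext p
  obtain ⟨⟨j, m⟩, rfl⟩ := posU.surjective p
  have h : (realU q).toKer f0.1 (posU (j, m)) = weightU q (j, m) * f0.1 (j, m) :=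
    rescale_apply _ _ (weightU_ne_zero q) _ _
  rw [h, posU_apply]
  by_cases hj : j = 0 ∧ m = 0
  · obtain ⟨rfl, rfl⟩ := hj
    simp [f0, weightU]
  · have : ¬ (m + j.toNat = 0 ∧ m + (-j).toNat = 0) := by omega
    simp only [f0, hj, if_false, mul_zero, Pi.single_apply, Prod.mk.injEq, and_true, this]

open Classical in
theorem toKer_e0 : (realX q).toKer e0 = Pi.single (0, 0, 0) 1 := by
  funext p
  obtain ⟨⟨⟨i₁, i₂, j₁, j₂, h₁, h₂⟩, m⟩, rfl⟩ := posX.surjective p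
  have h : ∀ k, (realX q).toKer e0 (posX k) = weightX q k * e0 k :=
    fun k => rescale_apply _ _ (weightX_ne_zero q) _ _
  rw [h, posX_apply]
  by_cases hk : i₁ = 0 ∧ i₂ = 0 ∧ j₁ = 0 ∧ j₂ = 0 ∧ m = 0
  · obtain ⟨rfl, rfl, rfl, rfl, rfl⟩ := hk
    simp [e0, weightX]
  · have : ¬ (m + i₁ = 0 ∧ m + j₁ = 0 ∧ (i₁ + i₂ - j₁ - j₂ : ℤ) = 0) := by
      rw [mul_eq_zero] at h₂
      omega
    simp only [e0, hk, if_false, mul_zero, Pi.single_apply, Prod.mk.injEq, this]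

theorem distMap_f0 : distMap q f0.1 = e0 := by
  classical
  apply (realX q).toKer.injective
  rw [toKer_distMap, toKer_f0, toKer_e0]
  funext ⟨r, s, b⟩
  by_cases hb : b = 0
  · subst hb
    simp [inclZero_zero, Pi.single_apply]
  · rw [inclZero_of_ne _ _ _ hb]
    simp [hb]

/-! ### Uniqueness -/

/-- The algebra of finite functions in the quantum disc is generated by `f₀` together with the
action of `U_q su(1,1)`. -/
theorem mem_of_closed (M : Submodule ℂ DistU) (h0 : f0.1 ∈ M)
    (hmul : ∀ f ∈ M, ∀ g ∈ M, distMul (coordU q) f g ∈ M) (hstar : ∀ f ∈ M, starDistU q f ∈ M)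
    (hact : ∀ ξ, ∀ f ∈ M, actDistU q ξ f ∈ M) {f : DistU} (hf : f ∈ FinU) : f ∈ M := by
  classical
  let E : ℕ → ℕ → Ker Unit := fun a b => Pi.single (a, b, ()) 1
  -- Row 0 of z is zero, so E_{n0} z = 0 and X⁺ E_{n0} reduces to a non-zero multiple of z E_{n0} =
  -- E_{n+1,0}.
  have hcol : ∀ n, (realU q).toKer.symm (E n 0) ∈ M := by
    intro n
    induction n with
    | zero =>
      rw [← (ContinuousLinearEquiv.symm_apply_eq _).2 (toKer_f0 q).symm] at h0
      exact h0
    | succ n ih =>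
      have h1 := hact .Xp _ ih
      rw [actDistU_eq, ContinuousLinearEquiv.apply_symm_apply] at h1
      have h2 : actKer q degU .Xp (E n 0)
          = (-(sq q / (1 - qc q ^ 2)) * sq q ^ (-(2 * (n : ℤ)))) • E (n + 1) 0 := by
        funext ⟨r, s, u⟩
        rcases r with _ | r
        · simp [E, actKer, opXp, zL, zR, lop_apply, rop_apply, opK, opKinv, wt]
        · by_cases hr : r = n ∧ s = 0
          · obtain ⟨rfl, rfl⟩ := hr
            simp [E, actKer, opXp, zL, zR, lop_apply, rop_apply, opK, opKinv, wt]
          · simp [E, actKer, opXp, zL, zR, lop_apply, rop_apply, opK, opKinv, wt,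
              hr]
      have h3 : -(sq q / (1 - qc q ^ 2)) * sq q ^ (-(2 * (n : ℤ))) ≠ 0 :=
        mul_ne_zero (neg_ne_zero.2 (div_ne_zero (sq_ne_zero q) (qc_pow_ne_one q two_ne_zero)))
          (zpow_ne_zero _ (sq_ne_zero q))
      rw [h2, map_smul] at h1
      exact (Submodule.smul_mem_iff M h3).1 h1
  have hrow : ∀ n, (realU q).toKer.symm (E 0 n) ∈ M := by
    intro n
    have h1 := hstar _ (hcol n)
    rw [starDistU_eq, ContinuousLinearEquiv.apply_symm_apply] at h1
    -- The involution transposes E_{n0} up to a ratio of norms, which is non-zero.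
    have h2 : starKer q (E n 0) = (normSq q n / normSq q 0 : ℂ) • E 0 n := by
      funext ⟨r, s, u⟩
      by_cases hr : r = 0 ∧ s = n
      · obtain ⟨rfl, rfl⟩ := hr
        simp [E, starKer_apply]
      · have hr' : ¬ (s = n ∧ r = 0) := fun h => hr ⟨h.2, h.1⟩
        simp [E, starKer_apply, hr, hr']
    rw [h2, map_smul] at h1
    exact (Submodule.smul_mem_iff M (div_ne_zero (normSq_ne_zero q _) (normSq_ne_zero q _))).1 h1
  have hE : ∀ a b, (realU q).toKer.symm (E a b) ∈ M := by
    intro a b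
    have h1 := hmul _ (hcol a) _ (hrow b)
    rw [(realU q).distMul_eq (S := {(0, b, ())}) _ (by
      rw [ContinuousLinearEquiv.apply_symm_apply, Finset.coe_singleton]
      exact Pi.support_single_subset), ContinuousLinearEquiv.apply_symm_apply,
      ContinuousLinearEquiv.apply_symm_apply] at h1
    -- This is E_{a0} E_{0b} = E_{ab}.
    have h2 : rmulFin {(0, b, ())} (E 0 b) (E a 0) = E a b := by
      funext ⟨r, s, u⟩
      simp [rmulFin, E, runit, rop_apply, Pi.single_apply]
      split_ifs <;> simp_all
    rwa [h2] at h1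
  have hF := (finite_support_toKerU q f).2 hf
  have h := sum_single_of_support (g := (realU q).toKer f) hF.coe_toFinset.ge
  have h' : f = ∑ p ∈ hF.toFinset, (realU q).toKer f p • (realU q).toKer.symm (E p.1 p.2.1) := by
    have h2 := congrArg (realU q).toKer.symm h
    rw [ContinuousLinearEquiv.symm_apply_apply, map_sum] at h2
    simp only [map_smul] at h2
    convert h2.symm
  rw [h']
  exact Submodule.sum_mem _ fun p _ => M.smul_mem _ (hE _ _)

/-- The finite functions on which both maps agree form a subspace containing f₀ and closed under
product, involution and action, so `mem_of_closed` applies. -/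
theorem eq_of_isCovariantStarIso {i i' : FinU ≃ FinX q} (hi : IsCovariantStarIso q i)
    (hi' : IsCovariantStarIso q i') (h0 : (i' f0).1 = (i f0).1) : i' = i := by
  let M : Submodule ℂ DistU :=
    { carrier := {f | ∃ h : f ∈ FinU, (i' ⟨f, h⟩).1 = (i ⟨f, h⟩).1}
      zero_mem' := ⟨FinU.zero_mem, by
        have h1 := hi'.map_smul 0 f0
        have h2 := hi.map_smul 0 f0
        rw [zero_smul, zero_smul] at h1 h2
        exact h1.trans h2.symm⟩
      add_mem' := by
        rintro f g ⟨hf, hf'⟩ ⟨hg, hg'⟩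
        refine ⟨FinU.add_mem hf hg, ?_⟩
        have h1 := hi'.map_add ⟨f, hf⟩ ⟨g, hg⟩
        have h2 := hi.map_add ⟨f, hf⟩ ⟨g, hg⟩
        rw [hf', hg', ← h2] at h1
        exact h1
      smul_mem' := by
        rintro c f ⟨hf, hf'⟩
        refine ⟨FinU.smul_mem c hf, ?_⟩
        have h1 := hi'.map_smul c ⟨f, hf⟩
        have h2 := hi.map_smul c ⟨f, hf⟩
        rw [hf', ← h2] at h1
        exact h1 }
  have key : ∀ f ∈ FinU, f ∈ M := fun f hf => by
    refine mem_of_closed q M ⟨f0.2, h0⟩ ?_ ?_ ?_ hf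
    · rintro f ⟨hf, hf'⟩ g ⟨hg, hg'⟩
      obtain ⟨h, e1, e2⟩ := hi.map_mul ⟨f, hf⟩ ⟨g, hg⟩
      obtain ⟨h', e1', e2'⟩ := hi'.map_mul ⟨f, hf⟩ ⟨g, hg⟩
      -- The product in D(U)_q does not depend on the map, so both existential witnesses are the
      -- same element.
      obtain rfl : h' = h := Subtype.ext (e1'.trans e1.symm)
      rw [hf', hg', ← e2] at e2'
      rw [← e1]
      exact ⟨h'.2, e2'⟩
    · rintro f ⟨hf, hf'⟩
      obtain ⟨h, e1, e2⟩ := hi.map_star ⟨f, hf⟩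
      obtain ⟨h', e1', e2'⟩ := hi'.map_star ⟨f, hf⟩
      obtain rfl : h' = h := Subtype.ext (e1'.trans e1.symm)
      rw [hf', ← e2] at e2'
      rw [← e1]
      exact ⟨h'.2, e2'⟩
    · rintro ξ f ⟨hf, hf'⟩
      obtain ⟨h, e1, e2⟩ := hi.map_act ξ ⟨f, hf⟩
      obtain ⟨h', e1', e2'⟩ := hi'.map_act ξ ⟨f, hf⟩
      obtain rfl : h' = h := Subtype.ext (e1'.trans e1.symm)
      rw [hf', ← e2] at e2'
      rw [← e1]
      exact ⟨h'.2, e2'⟩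
  refine Equiv.ext fun f => Subtype.ext ?_
  obtain ⟨_, h⟩ := key f.1 f.2
  exact h

/-! ### The inverses of `t₁₂` and `t₂₁` -/

open Classical in
/-- The matrix of `t₁₂⁻¹`. -/
def invT12 : Ker ℤ := fun p => if p.1 = p.2.1 ∧ p.2.2 = -1 then qc q ^ p.1 else 0

open Classical in
/-- The matrix of `t₂₁⁻¹`. -/
def invT21 : Ker ℤ := fun p => if p.1 = p.2.1 ∧ p.2.2 = 1 then -qc q ^ (p.1 + 1) else 0

theorem isInverseX_of_toKer {t : PolX q} {W : Ker ℤ} (h : leftX q t W = oneKer ℤ)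
    (h' : (rightX q t).unop W = oneKer ℤ) : IsInverseX q t ((realX q).toKer.symm W) := by
  have e : coordX q 1 = (realX q).toKer.symm (oneKer ℤ) := by
    rw [(realX q).coord_eq, map_one]
    rfl
  rw [IsInverseX, (realX q).polMul_eq, (realX q).mulPol_eq, e,
    ContinuousLinearEquiv.apply_symm_apply]
  exact ⟨congrArg _ h, congrArg _ h'⟩

theorem isInverseX_t12 : IsInverseX q (tX q .t12) ((realX q).toKer.symm (invT12 q)) := by
  have hq := qc_ne_zero q
  refine isInverseX_of_toKer q ?_ ?_
  · rw [leftX_tX]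
    funext ⟨r, s, b⟩
    simp [lop_apply, rowWtX, rowShiftX, rotDeg, invT12, oneKer, hq]
  · rw [rightX_tX]
    funext ⟨r, s, b⟩
    simp only [rop_apply, colWtX, colShiftX, rotDeg, invT12, oneKer, id]
    by_cases h : r = s ∧ b = 0
    · obtain ⟨rfl, rfl⟩ := h
      simp [hq]
    · simp [h]

theorem isInverseX_t21 : IsInverseX q (tX q .t21) ((realX q).toKer.symm (invT21 q)) := by
  have hq := qc_ne_zero q
  refine isInverseX_of_toKer q ?_ ?_
  · rw [leftX_tX]
    funext ⟨r, s, b⟩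
    simp [lop_apply, rowWtX, rowShiftX, rotDeg, invT21, oneKer, hq]
  · rw [rightX_tX]
    funext ⟨r, s, b⟩
    simp only [rop_apply, colWtX, colShiftX, rotDeg, invT21, oneKer, id]
    by_cases h : r = s ∧ b = 0
    · obtain ⟨rfl, rfl⟩ := h
      simp [hq]
    · simp [h]

/-- In row r > 0 the weights multiply to q · q^{-r} · q^{r-1} = 1, the weight of the shift z; row 0
is zero on both sides. -/
theorem distMap_z : distMap q (coordU q (gU q .z))
    = qc q • polMul (coordX q) (tX q .t11) ((realX q).toKer.symm (invT12 q)) := by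
  have hq := qc_ne_zero q
  rw [(realU q).coord_eq, distMap_toKer_symm, (realX q).polMul_eq,
    ContinuousLinearEquiv.apply_symm_apply, ← map_smul]
  congr 1
  change inclZero (leftU q _ _) = _ • leftX q _ _
  rw [leftU_gU, leftX_tX]
  funext ⟨r, s, b⟩
  by_cases hb : b = 0
  · subst hb
    rcases r with _ | r
    · simp [inclZero_zero, lop_apply, rowWtU, rowWtX]
    · simp [inclZero_zero, lop_apply, rowWtU, rowWtX, rowShiftU, rowShiftX, rotDeg, oneKer, invT12,
        pow_succ]
      field_simp
  · rw [inclZero_of_ne _ _ _ hb]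
    simp [lop_apply, rowShiftX, rotDeg, invT12, hb]

/-- Here t₂₂ is the right factor, so columns are compared: for s > 0 the weights give
(-q^s)(-q^{-s}(1 - q^{2s})) = 1 - q^{2s}, the weight of z*. -/
theorem distMap_zs : distMap q (coordU q (gU q .zs))
    = mulPol (coordX q) ((realX q).toKer.symm (invT21 q)) (tX q .t22) := by
  have hq := qc_ne_zero q
  rw [(realU q).coord_eq, distMap_toKer_symm, (realX q).mulPol_eq,
    ContinuousLinearEquiv.apply_symm_apply, ← (realU q).R_one]
  congr 1
  change inclZero ((rightU q _).unop _) = (rightX q _).unop _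
  rw [rightU_gU, rightX_tX]
  funext ⟨r, s, b⟩
  by_cases hb : b = 0
  · subst hb
    rcases s with _ | s
    · simp [inclZero_zero, rop_apply, colWtU, colWtX]
    · simp only [inclZero_zero, rop_apply, colWtU, colWtX, colShiftU, colShiftX, rotDeg, oneKer,
        invT21]
      by_cases hr : r = s
      · subst hr
        simp
        field_simp
      · simp [hr]
  · rw [inclZero_of_ne _ _ _ hb]
    simp [rop_apply, colShiftX, rotDeg, invT21, hb]

end Iso

end QDisc

end

/-! ### The isomorphism and its continuous extension -/

open QDisc in
theorem proposition3p1 (q : Set.Ioo (0 : ℝ) 1) :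
    ∃ i : FinU ≃ FinX q,
      (IsCovariantStarIso q i ∧ (i f0).1 = e0) ∧
      (∀ i' : FinU ≃ FinX q, IsCovariantStarIso q i' ∧ (i' f0).1 = e0 → i' = i) ∧
      ∃ j : DistU ≃ₜ DistX q,
        (∀ f : FinU, (j f.1).1 = (i f).1) ∧
        (∀ j' : DistU → DistX q, Continuous j' → (∀ f : FinU, (j' f.1).1 = (i f).1) → j' = j) ∧
        IsModuleIso q j ∧
        AgreesWithBimodules q i j ∧
        (∃ w : DistXt, IsInverseX q (tX q .t12) w ∧
          (j (coordU q (gU q .z))).1 = qc q • polMul (coordX q) (tX q .t11) w) ∧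
        (∃ v : DistXt, IsInverseX q (tX q .t21) v ∧
          (j (coordU q (gU q .zs))).1 = mulPol (coordX q) v (tX q .t22)) := by
  refine ⟨finIso q, ⟨isCovariantStarIso_finIso q, distMap_f0 q⟩, fun i' hi' =>
    eq_of_isCovariantStarIso q (isCovariantStarIso_finIso q) hi'.1
      (hi'.2.trans (distMap_f0 q).symm), distIso q, fun f => rfl, fun j' hj' h => ?_,
    ⟨fun F G => map_add (distMap q) F G, fun c F => map_smul (distMap q) c F,
      fun ξ F => distMap_actDistU q ξ F⟩,
    fun g F => ⟨distMap_mulDist q g.2 F, distMap_distMul q F g.2⟩,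
    ⟨_, isInverseX_t12 q, distMap_z q⟩, ⟨_, isInverseX_t21 q, distMap_zs q⟩⟩
  have hval : Continuous fun G : DistX q => G.1 := continuous_subtype_val
  -- Two continuous maps into a Hausdorff space that agree on the dense subspace of finite functions
  -- coincide.
  have key := Continuous.ext_on (dense_finDist (ℤ × ℕ)) (hval.comp hj') (distMap q).continuous
    fun f hf => h ⟨f, hf⟩
  exact funext fun F => Subtype.ext (congrFun key F)
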